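/- Throughout, $H$ and $E$ are Banach spaces over the same scalar field ($\mathbb{R}$ or $\mathbb{C}$), and $\mathcal{X}\subset\mathcal{L}(H,E)$ is a Banach space of bounded linear operators (a linear subspace of $\mathcal{L}(H,E)$ that is complete in a norm of its own) whose norm dominates the operator norm: $\|T\|_{\mathcal{L}(H,E)}\le\|T\|_{\mathcal{X}}$ for all $T\in\mathcal{X}$. For a family $\mathcal{T}\subset\mathcal{L}(H,E)$ let $\mathcal{R}(\mathcal{T})\in[0,\infty]$ be its R-bound, i.e. the smallest constant $C$ such that $$\mathbb{E}\Big\|\sum_{j=1}^N\varepsilon_jT_jx_j\Big\|^2\le C^2\,\mathbb{E}\Big\|\sum_{j=1}^N\varepsilon_jx_j\Big\|^2$$ for all $N$, all $T_1,\dots,T_N\in\mathcal{T}$ and all $x_1,\dots,x_N\in H$, where the $\varepsilon_j$ are independent random signs with $\mathbb{P}(\varepsilon_j=1)=\mathbb{P}(\varepsilon_j=-1)=1/2$; and $\mathcal{R}(\mathcal{T})=\infty$ if there is no such constant. Let $1<p<\infty$. The space $\mathcal{X}$ is said to have $\mathrm{RMF}_p$ if for every $\sigma$-finite measure space $(\Omega,\mathcal{F},\mu)$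 and every increasing sequence $(\mathcal{F}_j)_{j\in\mathbb{Z}}$ of sub-$\sigma$-algebras of $\mathcal{F}$ such that $\mu$ is $\sigma$-finite on each $\mathcal{F}_j$, the Rademacher maximal operator $$M_Rf(\xi)=\mathcal{R}\big(\mathbb{E}(f\mid\mathcal{F}_j)(\xi):j\in\mathbb{Z}\big),\qquad \xi\in\Omega,$$ is bounded from $L^p(\mu;\mathcal{X})$ to $L^p(\mu)$, i.e. there is a constant $C$ such that $\|M_Rf\|_{L^p}\le C\|f\|_{L^p(\mathcal{X})}$ for all $f\in L^p(\mu;\mathcal{X})$. Here $\mathbb{E}(f\mid\mathcal{F}_j)$ is the (almost everywhere unique) strongly $\mathcal{F}_j$-measurable function that is integrable on the sets $A\in\mathcal{F}_j$ of finite measure and satisfies $\int_A\mathbb{E}(f\mid\mathcal{F}_j)\,d\mu=\int_Af\,d\mu$ for these $A$. The space $\mathcal{X}$ is said to have weak RMF if there is a constant $C$ such that for every martingale $X=(X_j)_{j\ge1}$ in $\mathcal{X}$, on any probability space, with $\|X\|_1:=\sup_j\mathbb{E}\|X_j\|_{\mathcal{X}}<\infty$, $$\mathbb{P}(X_R^*>\lambda)\le\frac{C}{\lambda}\|X\|_1\quad\text{for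 all }\lambda>0,\qquad\text{where } X_R^*=\mathcal{R}(X_j:j\ge1).$$ **Theorem.** The following conditions are equivalent: 1. $\mathcal{X}$ has $\mathrm{RMF}_p$ for all $p\in(1,\infty)$. 2. $\mathcal{X}$ has $\mathrm{RMF}_p$ for some $p\in(1,\infty)$. 3. $\mathcal{X}$ has weak RMF. -/

import Mathlib

open MeasureTheory
open scoped NNReal ENNReal

universe w

namespace RademacherMaximal

/-- The second Rademacher moment `𝔼 ‖∑ j, ε j • x j‖ ^ 2` of vectors `x 0, …, x (N - 1)`.
Independent symmetric signs `ε` are uniformly distributed on `{-1, 1} ^ N`, so the expectation is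
the average over all `2 ^ N` choices of signs. -/
noncomputable def radSq {V : Type*} [NormedAddCommGroup V] {N : ℕ} (x : Fin N → V) : ℝ :=
  (2 ^ N : ℝ)⁻¹ * ∑ ε : Fin N → ℤˣ, ‖∑ j, (ε j : ℤ) • x j‖ ^ 2

section RBound

variable {𝕜 H E : Type*} [RCLike 𝕜] [NormedAddCommGroup H] [NormedSpace 𝕜 H]
  [NormedAddCommGroup E] [NormedSpace 𝕜 E]

/-- `C` is an admissible constant in the (exponent `2`) R-boundedness inequality of the family
`S`. The operators `T j` are chosen from `S` with repetitions allowed. -/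
def IsRBound (S : Set (H →L[𝕜] E)) (C : ℝ≥0) : Prop :=
  ∀ (N : ℕ) (T : Fin N → H →L[𝕜] E), (∀ j, T j ∈ S) → ∀ x : Fin N → H,
    radSq (fun j => T j (x j)) ≤ (C : ℝ) ^ 2 * radSq x

/-- The R-bound of a family of operators: the smallest admissible constant, and `∞` if the
family is not R-bounded. -/
noncomputable def rBound (S : Set (H →L[𝕜] E)) : ℝ≥0∞ :=
  ⨅ (C : ℝ≥0) (_ : IsRBound S C), (C : ℝ≥0∞)

end RBound

section CondExp

variable {Ω F : Type*} [NormedAddCommGroup F] [NormedSpace ℝ F]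

/-- `g` is a version of the conditional expectation of `f` with respect to `m`, where `f` is only
required to be integrable on sets of finite measure: `g` is strongly `m`-measurable (up to a null
set), integrable on the `m`-measurable sets of finite measure, and has the same integral as `f`
over each of these. For a measure that is `σ`-finite on `m` this determines `g` almost
everywhere. -/
structure IsCondExp (m : MeasurableSpace Ω) {m0 : MeasurableSpace Ω} (μ : Measure Ω)
    (f g : Ω → F) : Prop where
  aestronglyMeasurable : AEStronglyMeasurable[m] g μ
  integrableOn : ∀ A : Set Ω, MeasurableSet[m] A → μ A < ∞ → IntegrableOn g A μ
  setIntegral_eq : ∀ A : Set Ω, MeasurableSet[m] A → μ A < ∞ →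
    ∫ ω in A, g ω ∂μ = ∫ ω in A, f ω ∂μ

/-- Conditional expectations in the sense of `IsCondExp` exist. -/
theorem exists_isCondExp [CompleteSpace F]
    {m m0 : MeasurableSpace Ω} {μ : Measure Ω} (hm : m ≤ m0) [SigmaFinite (μ.trim hm)] {f : Ω → F}
    (hf : ∀ A : Set Ω, MeasurableSet A → μ A < ∞ → IntegrableOn f A μ) :
    ∃ g, IsCondExp m μ f g := by
  classical
  set D : ℕ → Set Ω := disjointed (spanningSets (μ.trim hm)) with hD
  have hDm : ∀ n, MeasurableSet[m] (D n) := fun n =>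
    MeasurableSet.disjointed (fun i => measurableSet_spanningSets (μ.trim hm) i) n
  have hDf : ∀ n, μ (D n) < ∞ := fun n => by
    refine lt_of_le_of_lt (measure_mono (disjointed_subset _ n)) ?_
    rw [← trim_measurableSet_eq hm (measurableSet_spanningSets (μ.trim hm) n)]
    exact measure_spanningSets_lt_top _ n
  have hDi : ∀ n, Integrable ((D n).indicator f) μ := fun n =>
    (hf _ (hm _ (hDm n)) (hDf n)).integrable_indicator (hm _ (hDm n))
  have hDU : ∀ ω, ∃ n, ω ∈ D n := fun ω => by
    have : ω ∈ ⋃ n, D n := by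
      rw [hD, iUnion_disjointed, iUnion_spanningSets]; trivial
    simpa using this
  have hDd : Pairwise (Function.onFun Disjoint D) := disjoint_disjointed _
  set g : Ω → F := fun ω => (μ[(D (Nat.find (hDU ω))).indicator f | m]) ω with hg
  have hgeq : ∀ n ω, ω ∈ D n → g ω = (μ[(D n).indicator f | m]) ω := by
    intro n ω hω
    have : Nat.find (hDU ω) = n := by
      by_contra hne
      exact Set.disjoint_left.1 (hDd hne) (Nat.find_spec (hDU ω)) hω
    simp only [hg, this]
  have hsm : StronglyMeasurable[m] g := by
    refine stronglyMeasurable_of_tendsto Filter.atTop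
      (f := fun (N : ℕ) ω => ∑ n ∈ Finset.range N, (D n).indicator (μ[(D n).indicator f | m]) ω) ?_ ?_
    · intro N
      exact Finset.stronglyMeasurable_fun_sum _ fun n _ =>
        stronglyMeasurable_condExp.indicator (hDm n)
    · rw [tendsto_pi_nhds]
      intro ω
      obtain ⟨n, hn⟩ := hDU ω
      refine tendsto_const_nhds.congr' ?_
      filter_upwards [Filter.eventually_gt_atTop n] with N hN
      rw [Finset.sum_eq_single n, Set.indicator_of_mem hn, hgeq n ω hn]
      · intro k _ hk
        exact Set.indicator_of_notMem (fun h => Set.disjoint_left.1 (hDd hk) h hn) _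
      · intro h; exact absurd (Finset.mem_range.2 hN) h
  have key : ∀ A : Set Ω, MeasurableSet[m] A → μ A < ∞ →
      g =ᵐ[μ.restrict A] μ[A.indicator f | m] := by
    intro A hA hAf
    have hAi : Integrable (A.indicator f) μ := (hf _ (hm _ hA) hAf).integrable_indicator (hm _ hA)
    have h1 : ∀ n, (D n).indicator (μ[A.indicator f | m]) =ᵐ[μ]
        A.indicator (μ[(D n).indicator f | m]) := by
      intro n
      refine (condExp_indicator hAi (hDm n)).symm.trans ?_
      rw [Set.indicator_indicator, Set.inter_comm, ← Set.indicator_indicator]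
      exact condExp_indicator (hDi n) hA
    rw [Filter.EventuallyEq, ae_restrict_iff' (hm _ hA)]
    filter_upwards [ae_all_iff.2 h1] with ω hω hωA
    obtain ⟨n, hn⟩ := hDU ω
    have := hω n
    rw [Set.indicator_of_mem hn, Set.indicator_of_mem hωA] at this
    rw [hgeq n ω hn, this]
  refine ⟨g, hsm.aestronglyMeasurable, fun A hA hAf => ?_, fun A hA hAf => ?_⟩
  · exact (integrable_condExp.integrableOn).congr (key A hA hAf).symm
  · have hAi : Integrable (A.indicator f) μ := (hf _ (hm _ hA) hAf).integrable_indicator (hm _ hA)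
    rw [integral_congr_ae (key A hA hAf), setIntegral_condExp hm hAi hA,
      setIntegral_indicator (hm _ hA), Set.inter_self]

end CondExp

section RMF

variable {𝕜 H E 𝓧 : Type*} [RCLike 𝕜] [NormedAddCommGroup H] [NormedSpace 𝕜 H]
  [NormedAddCommGroup E] [NormedSpace 𝕜 E] [NormedAddCommGroup 𝓧] [NormedSpace 𝕜 𝓧]

/-- The Rademacher maximal function `ω ↦ 𝓡 (Y j ω : j)` of a family of `𝓧`-valued functions, where
`𝓧` is regarded as a space of operators from `H` to `E` through `ι`. -/
noncomputable def radMax {Ω J : Type*} (ι : 𝓧 →ₗ[𝕜] H →L[𝕜] E) (Y : J → Ω → 𝓧) (ω : Ω) : ℝ≥0∞ :=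
  rBound (Set.range fun j => ι (Y j ω))

variable [NormedSpace ℝ 𝓧]

/-- `RMF_p` with respect to a given filtration on a given measure space: the Rademacher maximal
operator `f ↦ 𝓡 (𝔼 (f | ℱ j) : j ∈ ℤ)` is bounded from `L^p(𝓧)` to `L^p`. -/
def HasRMFWith {Ω : Type*} {m : MeasurableSpace Ω} (ι : 𝓧 →ₗ[𝕜] H →L[𝕜] E) (p : ℝ)
    (μ : Measure Ω) (ℱ : Filtration ℤ m) : Prop :=
  ∃ C : ℝ≥0, ∀ f : Ω → 𝓧, MemLp f (ENNReal.ofReal p) μ →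
    ∀ Y : ℤ → Ω → 𝓧, (∀ j, IsCondExp (ℱ j) μ f (Y j)) →
      eLpNorm (radMax ι Y) (ENNReal.ofReal p) μ ≤ C * eLpNorm f (ENNReal.ofReal p) μ

/-- `RMF_p`: the Rademacher maximal operator is bounded from `L^p(𝓧)` to `L^p` for every filtration
on every `σ`-finite measure space (the members of a filtration being `σ`-finite as well). -/
def HasRMF
    (ι : 𝓧 →ₗ[𝕜] H →L[𝕜] E) (p : ℝ) : Prop :=
  ∀ (Ω : Type w) (m : MeasurableSpace Ω) (μ : Measure Ω) [SigmaFinite μ] (ℱ : Filtration ℤ m)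
    [SigmaFiniteFiltration μ ℱ], HasRMFWith ι p μ ℱ

/-- The weak RMF property: `ℙ (X_R^* > t) ≤ (C / t) ‖X‖₁` for all `L^1`-bounded martingales `X` in
`𝓧`, on all probability spaces, where `‖X‖₁ = sup_j 𝔼 ‖X j‖`. -/
def HasWeakRMF [CompleteSpace 𝓧]
    (ι : 𝓧 →ₗ[𝕜] H →L[𝕜] E) : Prop :=
  ∃ C : ℝ≥0, ∀ (Ω : Type w) (m : MeasurableSpace Ω) (ℙ : Measure Ω) [IsProbabilityMeasure ℙ]
    (ℱ : Filtration ℕ m) (X : ℕ → Ω → 𝓧), Martingale X ℱ ℙ →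
    (⨆ j, eLpNorm (X j) 1 ℙ) < ∞ →
    ∀ t : ℝ≥0, 0 < t →
      ℙ {ω | (t : ℝ≥0∞) < radMax ι X ω} ≤ (C : ℝ≥0∞) / t * ⨆ j, eLpNorm (X j) 1 ℙ

end RMF

end RademacherMaximal

/-! The R-bound is subadditive, ignores operators replaced by zero, is at most the norm on a single
operator, and is determined by finite subfamilies. Hence the Rademacher maximal function of a
martingale can be stopped like an ordinary maximal function, at the cost of the norm of the last
term.

From weak RMF to `RMF_p`: let `τ` be the first time at which the running R-bound of `X n = 𝔼(f | ℱ
n)` exceeds `t`. Up to `τ` the R-bound is at most `t + ‖X τ‖`. The restarted martingale `X n - X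
(min n τ)` lives on `{X_R^* > t}` and has `L^1` norm at most `2 ∫ ‖f‖` over that set. The weak
inequality for it yields the Doob type estimate `HasWeakRMF.exists_meas_le_setLIntegral`, and
integration over the levels (`lintegral_rpow_le_of_meas_le`) gives `L^p` on finite measure spaces,
uniformly. Localisation and monotone convergence reach the `σ`-finite case with index set `ℤ`.

From `RMF_p` to weak RMF: the constant in `RMF_p` may a priori depend on the space and the
filtration. A disjoint union of bad examples shows that it need not (`HasRMF.exists_uniform`). The
Gundy decomposition `exists_gundy` writes an `L^1`-bounded martingale, off a small set, as a bounded
martingale plus a process of small total variation. Chebyshev's inequality with `RMF_p` controls the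
former, and the R-bound of the latter is at most its variation. -/

namespace RademacherMaximal

/-! ### Second Rademacher moments. -/

section RadSq

variable {V : Type*} [NormedAddCommGroup V] {N : ℕ}

theorem radSq_nonneg (x : Fin N → V) : 0 ≤ radSq x := by
  unfold radSq; positivity

/-- Multiplying the vectors by signs does not change their second Rademacher moment. -/
theorem radSq_units_smul (η : Fin N → ℤˣ) (x : Fin N → V) :
    radSq (fun j => (η j : ℤ) • x j) = radSq x := by
  unfold radSq
  congr 1
  refine Fintype.sum_equiv (Equiv.mulRight η) _ _ fun ε => ?_
  simp [mul_smul]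

/-- Minkowski's inequality for second Rademacher moments. -/
theorem radSq_add_le {x y : Fin N → V} {a b : ℝ} (ha : 0 ≤ a) (hb : 0 ≤ b)
    (hx : radSq x ≤ a ^ 2) (hy : radSq y ≤ b ^ 2) :
    radSq (fun j => x j + y j) ≤ (a + b) ^ 2 := by
  have hsqrt : ∀ z : Fin N → V, √(radSq z) =
      √((2 ^ N : ℝ)⁻¹) * √(∑ ε : Fin N → ℤˣ, ‖∑ j, (ε j : ℤ) • z j‖ ^ 2) := fun z => by
    rw [radSq, Real.sqrt_mul (by positivity)]
  have hx' : √(radSq x) ≤ a := Real.sqrt_le_iff.2 ⟨ha, hx⟩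
  have hy' : √(radSq y) ≤ b := Real.sqrt_le_iff.2 ⟨hb, hy⟩
  have key : √(radSq fun j => x j + y j) ≤ √(radSq x) + √(radSq y) := by
    rw [hsqrt, hsqrt, hsqrt, ← mul_add]
    refine mul_le_mul_of_nonneg_left ?_ (Real.sqrt_nonneg _)
    have h := norm_add_le
      (WithLp.toLp 2 fun ε : Fin N → ℤˣ => ‖∑ j, (ε j : ℤ) • x j‖ :
        EuclideanSpace ℝ (Fin N → ℤˣ))
      (WithLp.toLp 2 fun ε : Fin N → ℤˣ => ‖∑ j, (ε j : ℤ) • y j‖)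
    simp only [EuclideanSpace.norm_eq, Real.norm_eq_abs, sq_abs, PiLp.add_apply] at h
    refine le_trans (Real.sqrt_le_sqrt (Finset.sum_le_sum fun ε _ => ?_)) h
    have : ∑ j, (ε j : ℤ) • (x j + y j) =
        ∑ j, (ε j : ℤ) • x j + ∑ j, (ε j : ℤ) • y j := by
      simp [smul_add, Finset.sum_add_distrib]
    rw [this]
    exact pow_le_pow_left₀ (norm_nonneg _) (norm_add_le _ _) 2
  exact (Real.sqrt_le_iff.1 (key.trans (add_le_add hx' hy'))).2

/-- Omitting some of the vectors does not increase the second Rademacher moment. -/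
theorem radSq_ite_le (𝕜 : Type*) [RCLike 𝕜] [NormedSpace 𝕜 V] (A : Fin N → Prop)
    [DecidablePred A] (x : Fin N → V) :
    radSq (fun j => if A j then x j else 0) ≤ radSq x := by
  have h1 := radSq_units_smul (fun j => if A j then 1 else -1) x
  -- The truncated family is the average of `x` and of `x` with the signs flipped off `A`. These
  -- have the same moment, so convexity of the squared norm suffices.
  have h2 : radSq (fun j => if A j then x j else 0) ≤
      (radSq x + radSq fun j => (((if A j then 1 else -1 : ℤˣ)) : ℤ) • x j) / 2 := by
    unfold radSq
    rw [← mul_add, mul_div_assoc]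
    refine mul_le_mul_of_nonneg_left ?_ (by positivity)
    rw [← Finset.sum_add_distrib, Finset.sum_div]
    refine Finset.sum_le_sum fun ε _ => ?_
    set u := ∑ j, (ε j : ℤ) • x j
    set v := ∑ j, (ε j : ℤ) • (((if A j then 1 else -1 : ℤˣ)) : ℤ) • x j
    set y := ∑ j, (ε j : ℤ) • (if A j then x j else 0)
    have huv : u + v = y + y := by
      simp only [u, v, y, ← Finset.sum_add_distrib]
      refine Finset.sum_congr rfl fun j _ => ?_
      by_cases h : A j <;> simp [h]
    have h3 : ‖y + y‖ = 2 * ‖y‖ := by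
      rw [← two_smul 𝕜 y, norm_smul, RCLike.norm_two]
    have h4 : 2 * ‖y‖ ≤ ‖u‖ + ‖v‖ := by
      rw [← h3, ← huv]; exact norm_add_le _ _
    nlinarith [norm_nonneg y, sq_nonneg (‖u‖ - ‖v‖), norm_nonneg u, norm_nonneg v]
  linarith

end RadSq

/-! ### Calculus of R-bounds. -/

section RBound

variable {𝕜 H E : Type*} [RCLike 𝕜] [NormedAddCommGroup H] [NormedSpace 𝕜 H]
  [NormedAddCommGroup E] [NormedSpace 𝕜 E]

theorem IsRBound.mono {S S' : Set (H →L[𝕜] E)} {C C' : ℝ≥0} (h : IsRBound S C) (hS : S' ⊆ S)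
    (hC : C ≤ C') : IsRBound S' C' := fun N T hT x =>
  (h N T (fun j => hS (hT j)) x).trans <| mul_le_mul_of_nonneg_right
    (pow_le_pow_left₀ C.coe_nonneg (NNReal.coe_le_coe.2 hC) 2) (radSq_nonneg x)

/-- The infimum in the definition of the R-bound is attained. -/
theorem rBound_le_coe_iff {S : Set (H →L[𝕜] E)} {C : ℝ≥0} : rBound S ≤ C ↔ IsRBound S C := by
  refine ⟨fun h N T hT x => ?_, fun h => iInf₂_le C h⟩
  have hlt : ∀ D : ℝ≥0, C < D → radSq (fun j => T j (x j)) ≤ (D : ℝ) ^ 2 * radSq x := by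
    intro D hD
    have h1 : rBound S < D := h.trans_lt (by exact_mod_cast hD)
    simp only [rBound, iInf_lt_iff] at h1
    obtain ⟨C', hC', hlt⟩ := h1
    exact (hC'.mono subset_rfl (by exact_mod_cast hlt.le)) N T hT x
  have hcont : Filter.Tendsto (fun D : ℝ≥0 => (D : ℝ) ^ 2 * radSq x) (nhdsWithin C (Set.Ioi C))
      (nhds ((C : ℝ) ^ 2 * radSq x)) := by
    have : Continuous fun D : ℝ≥0 => (D : ℝ) ^ 2 * radSq x := by fun_prop
    exact (this.tendsto C).mono_left nhdsWithin_le_nhds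
  refine ge_of_tendsto hcont ?_
  filter_upwards [self_mem_nhdsWithin] with D hD using hlt D hD

theorem rBound_mono {S S' : Set (H →L[𝕜] E)} (h : S ⊆ S') : rBound S ≤ rBound S' := by
  refine le_iInf₂ fun C hC => ?_
  exact rBound_le_coe_iff.2 (hC.mono h le_rfl)

theorem isRBound_range_iff {J : Type*} {T : J → H →L[𝕜] E} {C : ℝ≥0} :
    IsRBound (Set.range T) C ↔ ∀ (N : ℕ) (s : Fin N → J) (x : Fin N → H),
      radSq (fun j => T (s j) (x j)) ≤ (C : ℝ) ^ 2 * radSq x := by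
  refine ⟨fun h N s x => h N (fun j => T (s j)) (fun j => ⟨s j, rfl⟩) x, fun h N U hU x => ?_⟩
  choose s hs using hU
  obtain rfl : (fun j => T (s j)) = U := funext hs
  exact h N s x

/-- R-bounds are determined by finite subfamilies. -/
theorem lt_rBound_range_iff {J : Type*} {T : J → H →L[𝕜] E} {C : ℝ≥0} :
    (C : ℝ≥0∞) < rBound (Set.range T) ↔ ∃ (N : ℕ) (s : Fin N → J) (x : Fin N → H),
      (C : ℝ) ^ 2 * radSq x < radSq (fun j => T (s j) (x j)) := by
  rw [← not_le, rBound_le_coe_iff, isRBound_range_iff]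
  push Not
  rfl

theorem rBound_range_add_le {J : Type*} (S T : J → H →L[𝕜] E) :
    rBound (Set.range fun j => S j + T j) ≤ rBound (Set.range S) + rBound (Set.range T) := by
  by_cases hS : rBound (Set.range S) = ∞
  · simp [hS]
  by_cases hT : rBound (Set.range T) = ∞
  · simp [hT]
  lift rBound (Set.range S) to ℝ≥0 using hS with a ha
  lift rBound (Set.range T) to ℝ≥0 using hT with b hb
  have hSa := isRBound_range_iff.1 (rBound_le_coe_iff.1 ha.ge)
  have hTb := isRBound_range_iff.1 (rBound_le_coe_iff.1 hb.ge)
  rw [← ENNReal.coe_add, rBound_le_coe_iff, isRBound_range_iff]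
  intro N s x
  have hx := Real.sq_sqrt (radSq_nonneg x)
  have h := radSq_add_le (x := fun j => S (s j) (x j)) (y := fun j => T (s j) (x j))
    (a := a * √(radSq x)) (b := b * √(radSq x)) (by positivity) (by positivity)
    (by rw [mul_pow, hx]; exact hSa N s x) (by rw [mul_pow, hx]; exact hTb N s x)
  rw [← add_mul, mul_pow, hx] at h
  simpa using h

/-- Replacing operators of a family by zero does not increase the R-bound. -/
theorem rBound_range_ite_le {J : Type*} (A : J → Prop) [DecidablePred A] {S : Set (H →L[𝕜] E)}
    {T : J → H →L[𝕜] E} (hT : ∀ j, A j → T j ∈ S) :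
    rBound (Set.range fun j => if A j then T j else 0) ≤ rBound S := by
  refine le_iInf₂ fun C hC => ?_
  rw [rBound_le_coe_iff, isRBound_range_iff]
  intro N s x
  by_cases hne : ∃ j₀, A j₀
  · obtain ⟨j₀, h₀⟩ := hne
    -- Zero need not belong to `S`. A vanishing operator is therefore simulated by some `T j₀` in
    -- `S` acting on the zero vector.
    have h := hC N (fun j => if A (s j) then T (s j) else T j₀)
      (fun j => by split_ifs with h; exacts [hT _ h, hT _ h₀])
      (fun j => if A (s j) then x j else 0)
    refine (le_of_eq ?_).trans (h.trans (mul_le_mul_of_nonneg_left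
      (radSq_ite_le 𝕜 (fun j => A (s j)) x) (by positivity)))
    congr 1
    funext j
    by_cases h : A (s j) <;> simp [h]
  · push Not at hne
    have : radSq (fun j => (if A (s j) then T (s j) else 0) (x j)) = 0 := by
      simp [radSq, hne]
    rw [this]
    have := radSq_nonneg x
    positivity

theorem rBound_singleton_le (T : H →L[𝕜] E) : rBound {T} ≤ ‖T‖ₑ := by
  rw [← ofReal_norm, ENNReal.ofReal, rBound_le_coe_iff]
  intro N U hU x
  rw [Real.coe_toNNReal _ (norm_nonneg _)]
  obtain rfl : U = fun _ => T := funext hU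
  unfold radSq
  rw [mul_left_comm, Finset.mul_sum (a := ‖T‖ ^ 2)]
  have hN : (0 : ℝ) ≤ (2 ^ N)⁻¹ := by positivity
  refine mul_le_mul_of_nonneg_left (Finset.sum_le_sum fun ε _ => ?_) hN
  rw [← mul_pow]
  refine pow_le_pow_left₀ (norm_nonneg _) ?_ 2
  have : ∑ j, (ε j : ℤ) • T (x j) = T (∑ j, (ε j : ℤ) • x j) := by simp
  rw [this]
  exact T.le_opNorm _

theorem rBound_range_zero {J : Type*} :
    rBound (Set.range fun _ : J => (0 : H →L[𝕜] E)) = 0 := by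
  refine le_antisymm ?_ bot_le
  refine (rBound_mono (Set.range_subset_singleton.2 ?_)).trans
    ((rBound_singleton_le (0 : H →L[𝕜] E)).trans_eq ?_)
  · rfl
  · rw [← ofReal_norm, norm_zero, ENNReal.ofReal_zero]

/-- The R-bound of a sequence of partial sums is at most the sum of the norms. -/
theorem rBound_range_sum_range_le (v : ℕ → H →L[𝕜] E) :
    rBound (Set.range fun n => ∑ k ∈ Finset.range n, v k) ≤ ∑' k, ‖v k‖ₑ := by
  -- For fixed `k`, the summand takes only the values `v k` and `0` as `n` varies, so it contributes
  -- at most `‖v k‖`.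
  have hfin : ∀ m : ℕ, rBound (Set.range fun n => ∑ k ∈ Finset.range m, if k < n then v k else 0) ≤
      ∑ k ∈ Finset.range m, ‖v k‖ₑ := by
    intro m
    induction m with
    | zero => simpa using (rBound_range_zero (J := ℕ) (𝕜 := 𝕜) (H := H) (E := E)).le
    | succ m ih =>
      simp only [Finset.sum_range_succ]
      refine (rBound_range_add_le _ _).trans (add_le_add ih ?_)
      exact (rBound_range_ite_le (fun n => m < n) (S := {v m}) fun _ _ => rfl).trans
        (rBound_singleton_le _)
  refine le_of_forall_lt fun c hc => ?_
  have hc' : c ≠ ∞ := hc.ne_top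
  lift c to ℝ≥0 using hc'
  obtain ⟨N, s, x, h⟩ := lt_rBound_range_iff.1 hc
  set m := ∑ j, s j
  have hs : ∀ j, s j ≤ m := fun j => Finset.single_le_sum (f := s) (by simp) (Finset.mem_univ j)
  refine lt_of_lt_of_le ?_ ((hfin m).trans (ENNReal.sum_le_tsum _))
  refine lt_rBound_range_iff.2 ⟨N, s, x, h.trans_eq ?_⟩
  congr 1
  funext j
  congr 1
  rw [← Finset.sum_filter]
  refine Finset.sum_congr ?_ fun _ _ => rfl
  ext k
  have := hs j
  simp only [Finset.mem_range, Finset.mem_filter]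
  omega

end RBound

/-! ### The Rademacher maximal function and its measurability. -/

section RadMax

variable {𝕜 H E 𝓧 : Type*} [RCLike 𝕜] [NormedAddCommGroup H] [NormedSpace 𝕜 H]
  [NormedAddCommGroup E] [NormedSpace 𝕜 E] [NormedAddCommGroup 𝓧] [NormedSpace 𝕜 𝓧]
  {Ω J : Type*} {ι : 𝓧 →ₗ[𝕜] H →L[𝕜] E}

theorem radMax_add_le (X Y : J → Ω → 𝓧) (ω : Ω) :
    radMax ι (fun j ω => X j ω + Y j ω) ω ≤ radMax ι X ω + radMax ι Y ω := by
  simp only [radMax, map_add]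
  exact rBound_range_add_le _ _

theorem radMax_congr {Ω' : Type*} {X : J → Ω → 𝓧} {Y : J → Ω' → 𝓧} {ω : Ω} {ω' : Ω'}
    (h : ∀ j, X j ω = Y j ω') : radMax ι X ω = radMax ι Y ω' := by
  simp only [radMax, h]

theorem radMax_reindex_le {J' : Type*} (X : J → Ω → 𝓧) (s : J' → J) (ω : Ω) :
    radMax ι (fun j => X (s j)) ω ≤ radMax ι X ω := by
  refine rBound_mono ?_
  rintro _ ⟨j, rfl⟩
  exact ⟨s j, rfl⟩

theorem radMax_eq_zero {X : J → Ω → 𝓧} {ω : Ω} (h : ∀ j, X j ω = 0) : radMax ι X ω = 0 := by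
  simp only [radMax, h, map_zero]
  exact rBound_range_zero

theorem radMax_sum_range_le (hι : ∀ T : 𝓧, ‖ι T‖ ≤ ‖T‖) (v : ℕ → Ω → 𝓧) (ω : Ω) :
    radMax ι (fun n ω => ∑ k ∈ Finset.range n, v k ω) ω ≤ ∑' k, ‖v k ω‖ₑ := by
  simp only [radMax, map_sum]
  refine (rBound_range_sum_range_le _).trans (ENNReal.tsum_le_tsum fun k => ?_)
  rw [← ofReal_norm, ← ofReal_norm]
  exact ENNReal.ofReal_le_ofReal (hι _)

theorem lt_radMax_iff {X : J → Ω → 𝓧} {ω : Ω} {t : ℝ≥0} :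
    (t : ℝ≥0∞) < radMax ι X ω ↔ ∃ (N : ℕ) (s : Fin N → J) (x : Fin N → H),
      (t : ℝ) ^ 2 * radSq x < radSq (fun j => ι (X (s j) ω) (x j)) :=
  lt_rBound_range_iff

/-- The Rademacher maximal function of a countable family of strongly measurable functions is
measurable. -/
theorem measurable_radMax [Countable J] (hι : ∀ T : 𝓧, ‖ι T‖ ≤ ‖T‖) {m : MeasurableSpace Ω}
    {X : J → Ω → 𝓧} (hX : ∀ j, StronglyMeasurable (X j)) : Measurable (radMax ι X) := by
  have hcont : Continuous ι := AddMonoidHomClass.continuous_of_bound ι 1 (by simpa using hι)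
  refine measurable_of_Ioi fun t => ?_
  rcases eq_or_ne t ∞ with rfl | ht
  · simp
  lift t to ℝ≥0 using ht
  -- The union over vectors `x` is uncountable, but it is a union of open sets in a finite power of
  -- `𝓧`, hence open. Only the unions over `N` and `s` have to be countable.
  have hset : radMax ι X ⁻¹' Set.Ioi (t : ℝ≥0∞) = ⋃ (N : ℕ) (s : Fin N → J),
      (fun ω j => X (s j) ω) ⁻¹' (⋃ x : Fin N → H,
        {T : Fin N → 𝓧 | (t : ℝ) ^ 2 * radSq x < radSq (fun j => ι (T j) (x j))}) := by
    ext ω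
    simp only [Set.mem_preimage, Set.mem_Ioi, lt_radMax_iff, Set.mem_iUnion, Set.mem_ofPred_eq]
  rw [hset]
  refine MeasurableSet.iUnion fun N => MeasurableSet.iUnion fun s => ?_
  borelize (Fin N → 𝓧)
  have hs : StronglyMeasurable fun ω j => X (s j) ω := by
    have h := Finset.stronglyMeasurable_fun_sum Finset.univ fun j (_ : j ∈ Finset.univ) =>
      (continuous_single (A := fun _ : Fin N => 𝓧) j).comp_stronglyMeasurable (hX (s j))
    convert h using 2 with ω
    exact (Finset.univ_sum_single _).symm
  refine hs.measurable (IsOpen.measurableSet (isOpen_iUnion fun x => ?_))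
  refine isOpen_lt continuous_const ?_
  unfold radSq
  have h1 : ∀ j, Continuous fun T : Fin N → 𝓧 => ι (T j) (x j) := fun j =>
    (ContinuousLinearMap.apply 𝕜 E (x j)).continuous.comp (hcont.comp (continuous_apply j))
  fun_prop

end RadMax

/-! ### Conditional expectations and martingales in `L^1`. -/

section Tools

variable {Ω F : Type*} [NormedAddCommGroup F] [NormedSpace ℝ F] [CompleteSpace F]
  {m0 : MeasurableSpace Ω} {μ : Measure Ω}

/-- Conditional expectation is a contraction in `L^1` of every set of the conditioning
`σ`-algebra. -/
theorem setLIntegral_enorm_condExp_le {m : MeasurableSpace Ω} (hm : m ≤ m0)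
    [SigmaFinite (μ.trim hm)] (f : Ω → F) {A : Set Ω} (hA : MeasurableSet[m] A) :
    ∫⁻ ω in A, ‖(μ[f | m]) ω‖ₑ ∂μ ≤ ∫⁻ ω in A, ‖f ω‖ₑ ∂μ := by
  by_cases hf : Integrable f μ
  swap
  · simp [condExp_of_not_integrable hf]
  calc ∫⁻ ω in A, ‖(μ[f | m]) ω‖ₑ ∂μ
      ≤ ∫⁻ ω in A, ENNReal.ofReal ((μ[(‖f ·‖) | m]) ω) ∂μ := by
        refine lintegral_mono_ae (ae_restrict_of_ae ?_)
        filter_upwards [norm_condExp_le (m := m) (μ := μ) f] with ω hω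
        rw [← ofReal_norm]
        exact ENNReal.ofReal_le_ofReal hω
    _ = ENNReal.ofReal (∫ ω in A, (μ[(‖f ·‖) | m]) ω ∂μ) := by
        rw [ofReal_integral_eq_lintegral_ofReal integrable_condExp.integrableOn]
        exact ae_restrict_of_ae (condExp_nonneg (ae_of_all _ fun _ => norm_nonneg _))
    _ = ∫⁻ ω in A, ‖f ω‖ₑ ∂μ := by
        rw [setIntegral_condExp hm hf.norm hA, integral_norm_eq_lintegral_enorm
          hf.aestronglyMeasurable.restrict, ENNReal.ofReal_toReal]
        exact (hf.integrableOn (s := A)).2.ne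

theorem setLIntegral_enorm_martingale_le [IsFiniteMeasure μ] {ℱ : Filtration ℕ m0}
    {X : ℕ → Ω → F} (hX : Martingale X ℱ μ) {i j : ℕ} (hij : i ≤ j) {A : Set Ω}
    (hA : MeasurableSet[ℱ i] A) : ∫⁻ ω in A, ‖X i ω‖ₑ ∂μ ≤ ∫⁻ ω in A, ‖X j ω‖ₑ ∂μ := by
  refine le_of_eq_of_le (lintegral_congr_ae (ae_restrict_of_ae ?_))
    (setLIntegral_enorm_condExp_le (ℱ.le i) (X j) hA)
  filter_upwards [hX.2 i j hij] with ω hω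
  rw [hω]

theorem martingale_smul_measure [IsFiniteMeasure μ] {ℱ : Filtration ℕ m0} {X : ℕ → Ω → F}
    (hX : Martingale X ℱ μ) {c : ℝ≥0∞} (hc : c ≠ ∞) : Martingale X ℱ (c • μ) := by
  have : IsFiniteMeasure (c • μ) := Measure.smul_finite μ hc
  refine martingale_of_setIntegral_eq_succ hX.1 (fun i => (hX.integrable i).smul_measure hc)
    fun i s hs => ?_
  rw [Measure.restrict_smul, integral_smul_measure, integral_smul_measure,
    hX.setIntegral_eq i.le_succ hs]

end Tools

/-! ### From a distributional inequality to an `L^p` inequality. -/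

section LayerCake

variable {Ω : Type*} {m0 : MeasurableSpace Ω} {μ : Measure Ω}

theorem ennreal_mul_rpow_sub_one {p : ℝ} (hp : 1 < p) (x : ℝ≥0∞) : x * x ^ (p - 1) = x ^ p := by
  rcases eq_or_ne x ∞ with rfl | hx
  · rw [ENNReal.top_rpow_of_pos (by linarith), ENNReal.top_rpow_of_pos (by linarith)]; simp
  rcases eq_or_ne x 0 with rfl | hx0
  · rw [zero_mul, ENNReal.zero_rpow_of_pos (by linarith)]
  rw [ENNReal.rpow_sub _ _ hx0 hx, ENNReal.rpow_one, ENNReal.mul_div_cancel hx0 hx]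

/-- A crude Young inequality: one of the two terms dominates alone, according to whether `g` or `δ *
v` is larger. A small `δ` lets the `v ^ p` term be absorbed later. -/
theorem ennreal_mul_rpow_sub_one_le {p : ℝ} (hp : 1 < p) {δ : ℝ≥0∞} (hδ : δ ≠ 0) (hδ' : δ ≠ ∞)
    (g v : ℝ≥0∞) : g * v ^ (p - 1) ≤ δ ^ (1 - p) * g ^ p + δ * v ^ p := by
  rcases le_total g (δ * v) with h | h
  · refine le_trans ?_ le_add_self
    calc g * v ^ (p - 1) ≤ δ * v * v ^ (p - 1) := by gcongr
      _ = δ * v ^ p := by rw [mul_assoc, ennreal_mul_rpow_sub_one hp]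
  · refine le_trans ?_ le_self_add
    have hv : v ≤ δ⁻¹ * g := by
      calc v = δ⁻¹ * (δ * v) := by rw [← mul_assoc, ENNReal.inv_mul_cancel hδ hδ', one_mul]
        _ ≤ δ⁻¹ * g := by gcongr
    calc g * v ^ (p - 1) ≤ g * (δ⁻¹ * g) ^ (p - 1) := by
          gcongr
      _ = δ ^ (1 - p) * g ^ p := by
          rw [ENNReal.mul_rpow_of_nonneg _ _ (by linarith), ENNReal.inv_rpow, ← ENNReal.rpow_neg,
            neg_sub, mul_left_comm, ennreal_mul_rpow_sub_one hp]

/-- The truncated form of `lintegral_rpow_le_of_meas_le`. -/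
theorem lintegral_min_rpow_le_of_meas_le {p : ℝ} (hp : 1 < p) {c : ℝ≥0} {f g : Ω → ℝ≥0∞}
    (hf : Measurable f) (hg : AEMeasurable g μ)
    (h : ∀ t : ℝ≥0, 0 < t → μ {ω | 3 * (t : ℝ≥0∞) < f ω} ≤
        c / t * ∫⁻ ω in {ω | (t : ℝ≥0∞) < f ω}, g ω ∂μ) (L : ℝ≥0) :
    ∫⁻ ω, (min (f ω) (3 * L) / 3) ^ p ∂μ ≤ ENNReal.ofReal p * (c * (ENNReal.ofReal (p - 1))⁻¹) *
      ∫⁻ ω, g ω * min (f ω) (3 * L) ^ (p - 1) ∂μ := by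
  have hp0 : 0 < p := by linarith
  have hp1 : 0 < p - 1 := by linarith
  -- With these two cutoffs, `{t < U}` and `{t < G}` are both empty for `t ≥ L`, while for `t < L`
  -- they are `{3 t < f}` and `{t < f}`, the sets in the hypothesis.
  set U : Ω → ℝ := fun ω => (min (f ω) (3 * L) / 3).toReal with hU
  set G : Ω → ℝ := fun ω => (min (f ω) L).toReal with hG
  have h3L : (3 * L : ℝ≥0∞) ≠ ∞ := by finiteness
  have hfin : ∀ ω, min (f ω) (3 * L) / 3 ≠ ∞ := fun ω =>
    ENNReal.div_ne_top (ne_top_of_le_ne_top h3L (min_le_right _ _)) (by simp)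
  have hfinG : ∀ ω, min (f ω) L ≠ ∞ := fun ω =>
    ne_top_of_le_ne_top ENNReal.coe_ne_top (min_le_right _ _)
  have hUm : Measurable U := ((hf.min measurable_const).div_const 3).ennreal_toReal
  have hGm : Measurable G := (hf.min measurable_const).ennreal_toReal
  -- With `g` as a density, the right side becomes a layer cake integral. The factor `1 / t` lowers
  -- its exponent from `p` to `p - 1`.
  set ν := μ.withDensity g with hν
  have hlevel : ∀ t : ℝ, 0 < t → μ {ω | t < U ω} * ENNReal.ofReal (t ^ (p - 1)) ≤
      c * (ν {ω | t < G ω} * ENNReal.ofReal (t ^ (p - 1 - 1))) := by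
    intro t ht
    lift t to ℝ≥0 using ht.le
    have ht' : 0 < t := by exact_mod_cast ht
    have hsub : {ω | (t : ℝ) < U ω} ⊆ {ω | 3 * (t : ℝ≥0∞) < f ω} ∩ {_ω | t < L} := by
      intro ω hω
      have h1 : (t : ℝ≥0∞) < min (f ω) (3 * L) / 3 := by
        rw [← ENNReal.toReal_lt_toReal ENNReal.coe_ne_top (hfin ω)]; exact hω
      rw [ENNReal.lt_div_iff_mul_lt (by simp) (by simp), lt_min_iff] at h1
      refine ⟨by rw [mul_comm]; exact h1.1, ?_⟩
      have h2 : ((t * 3 : ℝ≥0) : ℝ≥0∞) < ((3 * L : ℝ≥0) : ℝ≥0∞) := by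
        push_cast; exact h1.2
      have h3 : t * 3 < 3 * L := by exact_mod_cast h2
      rw [mul_comm] at h3
      exact lt_of_mul_lt_mul_left h3 (by positivity)
    by_cases htL : t < L
    swap
    · have : {ω | (t : ℝ) < U ω} = ∅ := by
        refine Set.subset_empty_iff.1 (hsub.trans ?_)
        rintro ω ⟨-, h⟩
        exact htL h
      simp [this]
    have hGset : {ω | (t : ℝ) < G ω} = {ω | (t : ℝ≥0∞) < f ω} := by
      ext ω
      have : (t : ℝ) < G ω ↔ (t : ℝ≥0∞) < min (f ω) L := by
        rw [← ENNReal.toReal_lt_toReal ENNReal.coe_ne_top (hfinG ω)]; rfl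
      change (t : ℝ) < G ω ↔ (t : ℝ≥0∞) < f ω
      rw [this, lt_min_iff]
      exact and_iff_left (by exact_mod_cast htL)
    have hνset : ν {ω | (t : ℝ) < G ω} = ∫⁻ ω in {ω | (t : ℝ≥0∞) < f ω}, g ω ∂μ := by
      rw [hGset]
      exact withDensity_apply _ (measurableSet_lt measurable_const hf)
    have hpow : ENNReal.ofReal ((t : ℝ) ^ (p - 1)) =
        t * ENNReal.ofReal ((t : ℝ) ^ (p - 1 - 1)) := by
      rw [← ENNReal.ofReal_coe_nnreal, ← ENNReal.ofReal_mul t.coe_nonneg,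
        Real.rpow_sub_one ht.ne' (p - 1), mul_div_cancel₀ _ ht.ne']
    have ht0 : (t : ℝ≥0∞) ≠ 0 := by exact_mod_cast ht'.ne'
    rw [hνset, hpow]
    calc μ {ω | (t : ℝ) < U ω} * (t * ENNReal.ofReal ((t : ℝ) ^ (p - 1 - 1)))
        ≤ (c / t * ∫⁻ ω in {ω | (t : ℝ≥0∞) < f ω}, g ω ∂μ) *
          (t * ENNReal.ofReal ((t : ℝ) ^ (p - 1 - 1))) := by
          gcongr
          exact (measure_mono (hsub.trans Set.inter_subset_left)).trans (h t ht')
      _ = c * ((∫⁻ ω in {ω | (t : ℝ≥0∞) < f ω}, g ω ∂μ) *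
          ENNReal.ofReal ((t : ℝ) ^ (p - 1 - 1))) * ((t : ℝ≥0∞)⁻¹ * t) := by
          rw [div_eq_mul_inv]; ring
      _ = _ := by rw [ENNReal.inv_mul_cancel ht0 ENNReal.coe_ne_top, mul_one]
  have hcake := lintegral_rpow_eq_lintegral_meas_lt_mul μ
    (ae_of_all _ fun ω => ENNReal.toReal_nonneg) hUm.aemeasurable hp0
  have hcake' := lintegral_rpow_eq_lintegral_meas_lt_mul ν
    (ae_of_all _ fun ω => ENNReal.toReal_nonneg) hGm.aemeasurable hp1
  have hUp : ∀ ω, (min (f ω) (3 * L) / 3) ^ p = ENNReal.ofReal (U ω ^ p) := fun ω => by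
    rw [hU, ENNReal.toReal_rpow, ENNReal.ofReal_toReal (by finiteness [hfin ω])]
  have hGp : ∀ ω, ENNReal.ofReal (G ω ^ (p - 1)) = min (f ω) L ^ (p - 1) := fun ω => by
    rw [hG, ENNReal.toReal_rpow, ENNReal.ofReal_toReal (by finiteness [hfinG ω])]
  have hp1' : ENNReal.ofReal (p - 1) ≠ 0 := by simpa using hp
  simp_rw [hUp]
  rw [hcake, mul_assoc]
  gcongr
  calc ∫⁻ t in Set.Ioi 0, μ {a | t < U a} * ENNReal.ofReal (t ^ (p - 1))
      ≤ ∫⁻ t in Set.Ioi 0, c * (ν {ω | t < G ω} * ENNReal.ofReal (t ^ (p - 1 - 1))) :=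
        setLIntegral_mono' measurableSet_Ioi fun t ht => hlevel t ht
    _ = c * (ENNReal.ofReal (p - 1))⁻¹ * (ENNReal.ofReal (p - 1) *
          ∫⁻ t in Set.Ioi 0, ν {ω | t < G ω} * ENNReal.ofReal (t ^ (p - 1 - 1))) := by
        rw [lintegral_const_mul' _ _ ENNReal.coe_ne_top, ← mul_assoc, mul_assoc (c : ℝ≥0∞),
          ENNReal.inv_mul_cancel hp1' ENNReal.ofReal_ne_top, mul_one]
    _ = c * (ENNReal.ofReal (p - 1))⁻¹ * ∫⁻ ω, min (f ω) L ^ (p - 1) ∂ν := by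
        rw [← hcake', lintegral_congr hGp]
    _ ≤ _ := by
        rw [hν, lintegral_withDensity_eq_lintegral_mul₀ hg
          ((hf.min measurable_const).pow_const _).aemeasurable]
        gcongr with ω
        refine mul_le_mul_right ?_ _
        have hL : (L : ℝ≥0∞) ≤ 3 * L := le_mul_of_one_le_left' (by norm_num)
        exact ENNReal.rpow_le_rpow (min_le_min le_rfl hL) hp1.le

/-- A function controlled by its own level sets: an inequality of Doob type in distribution
implies a strong `L^p` inequality. -/
theorem lintegral_rpow_le_of_meas_le {p : ℝ} (hp : 1 < p) (c : ℝ≥0) :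
    ∃ K : ℝ≥0, ∀ (Ω : Type w) (_ : MeasurableSpace Ω) (μ : Measure Ω) [IsFiniteMeasure μ]
      (f g : Ω → ℝ≥0∞), Measurable f → AEMeasurable g μ →
      (∀ t : ℝ≥0, 0 < t → μ {ω | 3 * (t : ℝ≥0∞) < f ω} ≤
        c / t * ∫⁻ ω in {ω | (t : ℝ≥0∞) < f ω}, g ω ∂μ) →
      ∫⁻ ω, f ω ^ p ∂μ ≤ K * ∫⁻ ω, g ω ^ p ∂μ := by
  have hp0 : 0 < p := by linarith
  have hp1' : ENNReal.ofReal (p - 1) ≠ 0 := by simpa using hp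
  have h3 : (3 : ℝ≥0∞) ^ p ≠ ∞ := by finiteness
  set a : ℝ≥0∞ := 3 ^ p * (ENNReal.ofReal p * (c * (ENNReal.ofReal (p - 1))⁻¹)) with ha
  have ha' : a ≠ ∞ := by finiteness
  -- Chosen so that `a * δ ≤ 1 / 2`, where the factor `3 ^ p` in `a` undoes the division by `3` in
  -- the truncated estimate.
  set δ : ℝ≥0∞ := (2 * (a + 1))⁻¹ with hδ
  have hδ0 : δ ≠ 0 := ENNReal.inv_ne_zero.2 (by finiteness)
  have hδt : δ ≠ ∞ := ENNReal.inv_ne_top.2 (by positivity)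
  have haδ : a * δ ≤ 2⁻¹ := by
    rw [hδ, ENNReal.mul_inv (by simp) (by simp), mul_left_comm]
    refine mul_le_of_le_one_right' ?_
    exact (mul_le_mul_left le_self_add _).trans (ENNReal.mul_inv_le_one _)
  have hKt : 2 * (a * δ ^ (1 - p)) ≠ ∞ := by
    refine ENNReal.mul_ne_top (by simp) (ENNReal.mul_ne_top ha' ?_)
    exact ENNReal.rpow_ne_top_of_ne_zero hδ0 hδt
  refine ⟨(2 * (a * δ ^ (1 - p))).toNNReal, fun Ω m0 μ _ f g hf hg h => ?_⟩
  rw [ENNReal.coe_toNNReal hKt]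
  have htrunc : ∀ L : ℝ≥0, ∫⁻ ω, min (f ω) (3 * L) ^ p ∂μ ≤
      2 * (a * δ ^ (1 - p)) * ∫⁻ ω, g ω ^ p ∂μ := by
    intro L
    set x := ∫⁻ ω, min (f ω) (3 * L) ^ p ∂μ with hx
    -- The reason for truncating: half of `x` is about to be subtracted from both sides.
    have hxt : x ≠ ∞ := by
      refine ne_top_of_le_ne_top (b := ∫⁻ _, (3 * L : ℝ≥0∞) ^ p ∂μ) ?_
        (lintegral_mono fun ω => ENNReal.rpow_le_rpow (min_le_right _ _) hp0.le)
      rw [lintegral_const]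
      finiteness
    have h1 : x ≤ a * ∫⁻ ω, g ω * min (f ω) (3 * L) ^ (p - 1) ∂μ := by
      have := mul_le_mul_right (lintegral_min_rpow_le_of_meas_le hp hf hg h L) (3 ^ p)
      rw [← mul_assoc, ← lintegral_const_mul' _ _ h3] at this
      refine le_of_eq_of_le (lintegral_congr fun ω => ?_) this
      rw [← ENNReal.mul_rpow_of_nonneg _ _ hp0.le, ENNReal.mul_div_cancel (by simp) (by simp)]
    have h2 : ∫⁻ ω, g ω * min (f ω) (3 * L) ^ (p - 1) ∂μ ≤
        δ ^ (1 - p) * ∫⁻ ω, g ω ^ p ∂μ + δ * x := by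
      rw [← lintegral_const_mul' _ _ (ENNReal.rpow_ne_top_of_ne_zero hδ0 hδt), hx,
        ← lintegral_const_mul' _ _ hδt, ← lintegral_add_left' ((hg.pow_const p).const_mul _)]
      exact lintegral_mono fun ω => ennreal_mul_rpow_sub_one_le hp hδ0 hδt _ _
    have h3 : x ≤ a * δ ^ (1 - p) * ∫⁻ ω, g ω ^ p ∂μ + 2⁻¹ * x := by
      refine (h1.trans (mul_le_mul_right h2 a)).trans ?_
      rw [mul_add, ← mul_assoc, ← mul_assoc]
      gcongr
    have h4 : 2⁻¹ * x + 2⁻¹ * x = x := by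
      rw [← add_mul, ENNReal.inv_two_add_inv_two, one_mul]
    have h5 : 2⁻¹ * x ≤ a * δ ^ (1 - p) * ∫⁻ ω, g ω ^ p ∂μ := by
      refine (ENNReal.add_le_add_iff_right (a := 2⁻¹ * x) (by finiteness)).1 ?_
      rw [h4]; exact h3
    calc x = 2 * (2⁻¹ * x) := by
          rw [← mul_assoc, ENNReal.mul_inv_cancel (by simp) (by simp), one_mul]
      _ ≤ 2 * (a * δ ^ (1 - p) * ∫⁻ ω, g ω ^ p ∂μ) := by gcongr
      _ = _ := by ring
  have hlim : Filter.Tendsto (fun n : ℕ => ∫⁻ ω, min (f ω) (3 * (n : ℝ≥0)) ^ p ∂μ) Filter.atTop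
      (nhds (∫⁻ ω, f ω ^ p ∂μ)) := by
    refine lintegral_tendsto_of_tendsto_of_monotone
      (fun n => ((hf.min measurable_const).pow_const p).aemeasurable)
      (ae_of_all _ fun ω i j hij => ?_) (ae_of_all _ fun ω => ?_)
    · refine ENNReal.rpow_le_rpow (min_le_min le_rfl ?_) hp0.le
      gcongr
    · refine (ENNReal.continuous_rpow_const.tendsto _).comp ?_
      have : Filter.Tendsto (fun n : ℕ => (3 * ((n : ℝ≥0) : ℝ≥0∞))) Filter.atTop (nhds ∞) := by
        have := ENNReal.Tendsto.const_mul (a := 3) ENNReal.tendsto_nat_nhds_top (Or.inr (by simp))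
        simpa using this
      simpa using (tendsto_const_nhds (x := f ω)).min this
  exact le_of_tendsto' hlim fun n => htrunc n

end LayerCake

/-! ### Stopping a sequence at a given R-bound. -/

section Stopping

theorem mem_disjointed_iff {Ω : Type*} {P : ℕ → Set Ω} {m : ℕ} {ω : Ω} :
    ω ∈ disjointed P m ↔ ω ∈ P m ∧ ∀ i < m, ω ∉ P i := by
  simp [disjointed_eq_inter_compl]

theorem measurableSet_disjointed_filtration {Ω : Type*} {m : MeasurableSpace Ω}
    {ℱ : Filtration ℕ m} {P : ℕ → Set Ω} (hP : ∀ n, MeasurableSet[ℱ n] (P n)) (n : ℕ) :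
    MeasurableSet[ℱ n] (disjointed P n) := by
  rw [disjointed_eq_inter_compl]
  exact (hP n).inter (MeasurableSet.iInter fun i => MeasurableSet.iInter fun hi =>
    (ℱ.mono hi.le _ (hP i)).compl)

variable {𝕜 H E 𝓧 : Type*} [RCLike 𝕜] [NormedAddCommGroup H] [NormedSpace 𝕜 H]
  [NormedAddCommGroup E] [NormedSpace 𝕜 E] [NormedAddCommGroup 𝓧] [NormedSpace 𝕜 𝓧]
  {Ω : Type*} {ι : 𝓧 →ₗ[𝕜] H →L[𝕜] E}

/-- The family `fun j => X (min j n)` encodes `X 0, …, X n` with index set `ℕ`, so that all running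
R-bounds are instances of `radMax` over the same index type. -/
theorem radMax_min_le (X : ℕ → Ω → 𝓧) (n : ℕ) (ω : Ω) :
    radMax ι (fun j => X (min j n)) ω ≤ radMax ι X ω :=
  radMax_reindex_le X (min · n) ω

theorem radMax_min_mono (X : ℕ → Ω → 𝓧) (ω : Ω) :
    Monotone fun n => radMax ι (fun j => X (min j n)) ω := by
  intro n k hnk
  have := radMax_reindex_le (ι := ι) (fun j => X (min j k)) (min · n) ω
  simpa only [min_assoc, min_eq_left hnk] using this

/-- A strict violation of the bound involves finitely many indices, and their sum is an upper bound
for all of them. -/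
theorem lt_radMax_iff_exists_min {X : ℕ → Ω → 𝓧} {ω : Ω} {t : ℝ≥0} :
    (t : ℝ≥0∞) < radMax ι X ω ↔ ∃ n, (t : ℝ≥0∞) < radMax ι (fun j => X (min j n)) ω := by
  refine ⟨fun h => ?_, fun ⟨n, hn⟩ => hn.trans_le (radMax_min_le X n ω)⟩
  obtain ⟨N, s, x, h⟩ := lt_radMax_iff.1 h
  refine ⟨∑ j, s j, lt_radMax_iff.2 ⟨N, s, x, h.trans_eq ?_⟩⟩
  congr 1
  funext j
  rw [min_eq_left (Finset.single_le_sum (f := s) (by simp) (Finset.mem_univ j))]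

theorem radMax_ite_const_le (hι : ∀ T : 𝓧, ‖ι T‖ ≤ ‖T‖) {J : Type*} (A : J → Prop)
    [DecidablePred A] (Z : Ω → 𝓧) (ω : Ω) :
    radMax ι (fun j ω => if A j then Z ω else 0) ω ≤ ‖Z ω‖ₑ := by
  have h : ∀ j, ι (if A j then Z ω else 0) = if A j then ι (Z ω) else 0 := fun j => by
    split_ifs <;> simp
  simp only [radMax, h]
  refine (rBound_range_ite_le A (S := {ι (Z ω)}) fun _ _ => rfl).trans
    ((rBound_singleton_le _).trans ?_)
  rw [← ofReal_norm, ← ofReal_norm]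
  exact ENNReal.ofReal_le_ofReal (hι _)

/-- A sequence stopped when its R-bound first exceeds `t` has R-bound at most `t` plus the norm of
the last term. -/
theorem radMax_min_le_add (hι : ∀ T : 𝓧, ‖ι T‖ ≤ ‖T‖) {X : ℕ → Ω → 𝓧} {ω : Ω} {t : ℝ≥0∞} {m : ℕ}
    (h : ∀ i < m, radMax ι (fun j => X (min j i)) ω ≤ t) :
    radMax ι (fun j => X (min j m)) ω ≤ t + ‖X m ω‖ₑ := by
  have hsplit : radMax ι (fun j => X (min j m)) ω =
      radMax ι (fun j ω => (if j < m then X j ω else 0) + if m ≤ j then X m ω else 0) ω := by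
    refine radMax_congr fun j => ?_
    rcases lt_or_ge j m with hj | hj
    · simp [hj, hj.le, not_le.2 hj]
    · simp [hj, not_lt.2 hj]
  rw [hsplit]
  refine (radMax_add_le _ _ ω).trans (add_le_add ?_ (radMax_ite_const_le hι _ _ ω))
  cases m with
  | zero => exact (radMax_eq_zero fun j => by simp).trans_le bot_le
  | succ m =>
    refine le_trans ?_ (h m m.lt_succ_self)
    have h' : ∀ j, ι (if j < m + 1 then X j ω else 0) = if j < m + 1 then ι (X j ω) else 0 :=
      fun j => by split_ifs <;> simp
    simp only [radMax, h']
    refine rBound_range_ite_le _ fun j hj => ⟨j, ?_⟩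
    simp only [min_eq_left (Nat.lt_succ_iff.1 hj)]

theorem aemeasurable_radMax {J : Type*} [Countable J] (hι : ∀ T : 𝓧, ‖ι T‖ ≤ ‖T‖)
    {m : MeasurableSpace Ω} {μ : Measure Ω} {X : J → Ω → 𝓧}
    (hX : ∀ j, AEStronglyMeasurable (X j) μ) : AEMeasurable (radMax ι X) μ := by
  refine ⟨radMax ι fun j => (hX j).mk (X j),
    measurable_radMax hι fun j => (hX j).stronglyMeasurable_mk, ?_⟩
  filter_upwards [ae_all_iff.2 fun j => (hX j).ae_eq_mk] with ω hω
  exact radMax_congr hω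

end Stopping

/-! ### Weak RMF implies `L^p` bounds on finite measure spaces. -/

section Strong

variable {𝕜 H E 𝓧 : Type*} [RCLike 𝕜] [NormedAddCommGroup H] [NormedSpace 𝕜 H]
  [NormedAddCommGroup E] [NormedSpace 𝕜 E] [NormedAddCommGroup 𝓧] [NormedSpace 𝕜 𝓧]
  [NormedSpace ℝ 𝓧] [CompleteSpace 𝓧] {ι : 𝓧 →ₗ[𝕜] H →L[𝕜] E}

/-- The weak RMF inequality passes from probability measures to finite measures. -/
theorem HasWeakRMF.exists_meas_le (h : HasWeakRMF.{w} ι) :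
    ∃ C : ℝ≥0, ∀ (Ω : Type w) (m : MeasurableSpace Ω) (μ : Measure Ω) [IsFiniteMeasure μ]
      (ℱ : Filtration ℕ m) (X : ℕ → Ω → 𝓧), Martingale X ℱ μ →
      ∀ B : ℝ≥0∞, B ≠ ∞ → (∀ j, ∫⁻ ω, ‖X j ω‖ₑ ∂μ ≤ B) → ∀ t : ℝ≥0, 0 < t →
        μ {ω | (t : ℝ≥0∞) < radMax ι X ω} ≤ C / t * B := by
  obtain ⟨C, hC⟩ := h
  refine ⟨C, fun Ω m μ _ ℱ X hX B hB hXB t ht => ?_⟩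
  rcases eq_or_ne μ 0 with rfl | hμ
  · simp
  have hμ0 : μ Set.univ ≠ 0 := by simpa using hμ
  have hμt : μ Set.univ ≠ ∞ := measure_ne_top _ _
  set c := (μ Set.univ)⁻¹ with hc
  have hct : c ≠ ∞ := ENNReal.inv_ne_top.2 hμ0
  have : IsProbabilityMeasure (c • μ) := ⟨by
    rw [Measure.smul_apply, smul_eq_mul, hc, ENNReal.inv_mul_cancel hμ0 hμt]⟩
  have hsup : ⨆ j, eLpNorm (X j) 1 (c • μ) ≤ c * B := iSup_le fun j => by
    rw [eLpNorm_one_eq_lintegral_enorm, lintegral_smul_measure, smul_eq_mul]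
    exact mul_le_mul_right (hXB j) c
  have := (hC Ω m (c • μ) ℱ X (martingale_smul_measure hX hct)
    (hsup.trans_lt (by finiteness)) t ht).trans (mul_le_mul_right hsup _)
  rw [Measure.smul_apply, smul_eq_mul] at this
  have hcancel : ∀ x : ℝ≥0∞, μ Set.univ * (c * x) = x := fun x => by
    rw [← mul_assoc, hc, ENNReal.mul_inv_cancel hμ0 hμt, one_mul]
  have := mul_le_mul_right this (μ Set.univ)
  rwa [hcancel, mul_left_comm (_ / _), hcancel] at this

/-- The terms of a martingale at a stopping time, in `L^1`. The events `G k` are those where the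
stopping time has the value `k`. -/
theorem tsum_setLIntegral_condExp_le {Ω : Type*} {m : MeasurableSpace Ω} {μ : Measure Ω}
    [IsFiniteMeasure μ] {ℱ : Filtration ℕ m} (f : Ω → 𝓧) {G : ℕ → Set Ω}
    (hG : ∀ k, MeasurableSet[ℱ k] (G k)) (hd : Pairwise (Function.onFun Disjoint G)) :
    ∑' k, ∫⁻ ω in G k, ‖(μ[f | ℱ k]) ω‖ₑ ∂μ ≤ ∫⁻ ω in ⋃ k, G k, ‖f ω‖ₑ ∂μ := by
  rw [lintegral_iUnion (fun k => ℱ.le k _ (hG k)) hd]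
  exact ENNReal.tsum_le_tsum fun k => setLIntegral_enorm_condExp_le (ℱ.le k) f (hG k)

/-- Martingale transforms by predictable indicators. -/
theorem martingale_sum_indicator {Ω : Type*} {m : MeasurableSpace Ω} {μ : Measure Ω}
    [IsFiniteMeasure μ] {ℱ : Filtration ℕ m} {X : ℕ → Ω → 𝓧} (hX : Martingale X ℱ μ)
    {P : ℕ → Set Ω} (hP : ∀ k, MeasurableSet[ℱ k] (P k)) :
    Martingale (fun n ω => ∑ k ∈ Finset.range n, (P k).indicator (X (k + 1) - X k) ω) ℱ μ := by
  have hint : ∀ k, Integrable ((P k).indicator (X (k + 1) - X k)) μ := fun k =>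
    ((hX.integrable (k + 1)).sub (hX.integrable k)).indicator (ℱ.le k _ (hP k))
  refine martingale_of_setIntegral_eq_succ (fun n => ?_)
    (fun n => integrable_finsetSum _ fun k _ => hint k) fun n s hs => ?_
  · refine Finset.stronglyMeasurable_fun_sum _ fun k hk => ?_
    have hk' : k + 1 ≤ n := Finset.mem_range.1 hk
    exact (((hX.1 (k + 1)).mono (ℱ.mono hk')).sub
      ((hX.1 k).mono (ℱ.mono (k.le_succ.trans hk')))).indicator
        (ℱ.mono (k.le_succ.trans hk') _ (hP k))
  · simp only [Finset.sum_range_succ]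
    rw [integral_add (integrable_finsetSum _ fun k _ => (hint k).integrableOn)
      (hint n).integrableOn, setIntegral_indicator (ℱ.le n _ (hP n))]
    have h0 : ∫ ω in s ∩ P n, (X (n + 1) - X n) ω ∂μ = 0 := by
      have := hX.setIntegral_eq n.le_succ (hs.inter (hP n))
      simp only [Pi.sub_apply]
      rw [integral_sub (hX.integrable _).integrableOn (hX.integrable _).integrableOn, this, sub_self]
    rw [h0, add_zero]

/-- Under weak RMF, the Rademacher maximal function of a closed martingale satisfies an inequality
of Doob type. -/
theorem HasWeakRMF.exists_meas_le_setLIntegral (hι : ∀ T : 𝓧, ‖ι T‖ ≤ ‖T‖)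
    (h : HasWeakRMF.{w} ι) :
    ∃ C : ℝ≥0, ∀ (Ω : Type w) (m : MeasurableSpace Ω) (μ : Measure Ω) [IsFiniteMeasure μ]
      (ℱ : Filtration ℕ m) (f : Ω → 𝓧), Integrable f μ → ∀ t : ℝ≥0, 0 < t →
        μ {ω | 3 * (t : ℝ≥0∞) < radMax ι (fun n => μ[f | ℱ n]) ω} ≤
          C / t * ∫⁻ ω in {ω | (t : ℝ≥0∞) < radMax ι (fun n => μ[f | ℱ n]) ω}, ‖f ω‖ₑ ∂μ := by
  obtain ⟨C, hC⟩ := h.exists_meas_le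
  -- The `1` comes from Markov's inequality for `‖X τ‖`, the `2 * C` from the weak inequality for
  -- the restarted martingale.
  refine ⟨1 + C * 2, fun Ω m μ _ ℱ f hf t ht => ?_⟩
  set X : ℕ → Ω → 𝓧 := fun n => μ[f | ℱ n] with hXdef
  have hX : Martingale X ℱ μ := martingale_condExp f ℱ μ
  -- With `τ` the first time at which the running R-bound exceeds `t`, `P n` is `{τ ≤ n}` and `G n`
  -- below is `{τ = n}`.
  set P : ℕ → Set Ω := fun n => {ω | (t : ℝ≥0∞) < radMax ι (fun j => X (min j n)) ω} with hPdef
  have hP : ∀ n, MeasurableSet[ℱ n] (P n) := fun n => by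
    have : Measurable[ℱ n] (radMax ι (fun j => X (min j n))) :=
      measurable_radMax hι fun j => (hX.1 _).mono (ℱ.mono (min_le_right j n))
    exact this measurableSet_Ioi
  have hPmono : Monotone P := fun n k hnk ω hω => lt_of_lt_of_le hω (radMax_min_mono X ω hnk)
  have hPU : {ω | (t : ℝ≥0∞) < radMax ι X ω} = ⋃ n, P n := by
    ext ω
    rw [Set.mem_iUnion]
    exact lt_radMax_iff_exists_min
  rw [hPU]
  set I := ∫⁻ ω in ⋃ n, P n, ‖f ω‖ₑ ∂μ with hI
  have hIt : I ≠ ∞ := ne_top_of_le_ne_top hf.2.ne (setLIntegral_le_lintegral _ _)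
  set G := disjointed P with hGdef
  have hG : ∀ n, MeasurableSet[ℱ n] (G n) := measurableSet_disjointed_filtration hP
  -- This is `‖X τ‖`, with the value `0` where `τ` is infinite.
  set S : Ω → ℝ≥0∞ := fun ω => ∑' k, (G k).indicator (fun ω => ‖X k ω‖ₑ) ω with hSdef
  have hSmeas : ∀ k, Measurable ((G k).indicator fun ω => ‖X k ω‖ₑ) := fun k =>
    ((hX.1 k).mono (ℱ.le k)).enorm.indicator (ℱ.le k _ (hG k))
  have hSm : Measurable S := Measurable.tsum hSmeas
  have hSI : ∫⁻ ω, S ω ∂μ ≤ I := by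
    rw [hSdef, lintegral_tsum fun k => (hSmeas k).aemeasurable]
    simp_rw [lintegral_indicator (ℱ.le _ _ (hG _))]
    refine (tsum_setLIntegral_condExp_le f hG (disjoint_disjointed P)).trans_eq ?_
    rw [hGdef, iUnion_disjointed]
  have hS : ∀ k ω, ω ∈ G k → ‖X k ω‖ₑ ≤ S ω := fun k ω hω => by
    refine le_trans ?_ (ENNReal.le_tsum k)
    rw [Set.indicator_of_mem hω]
  -- The restarted martingale `X n - X (min n τ)`, written as a transform because `{τ ≤ k}` belongs
  -- to `ℱ k`.
  set Y : ℕ → Ω → 𝓧 := fun n ω => ∑ k ∈ Finset.range n, (P k).indicator (X (k + 1) - X k) ω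
    with hYdef
  have hY : Martingale Y ℱ μ := martingale_sum_indicator hX hP
  have hYm : ∀ m ω, ω ∈ G m → ∀ n, Y n ω = X n ω - X (min n m) ω := by
    intro m ω hω n
    obtain ⟨hm, hi⟩ := mem_disjointed_iff.1 hω
    induction n with
    | zero => simp [hYdef]
    | succ n ih =>
      have : Y (n + 1) ω = Y n ω + (P n).indicator (X (n + 1) - X n) ω := by
        simp only [hYdef, Finset.sum_range_succ]
      rw [this, ih]
      rcases lt_or_ge n m with hn | hn
      · rw [Set.indicator_of_notMem (hi n hn), min_eq_left hn.le, min_eq_left (Nat.succ_le_of_lt hn)]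
        simp
      · rw [Set.indicator_of_mem (hPmono hn hm), min_eq_right hn, min_eq_right (hn.trans n.le_succ),
          Pi.sub_apply]
        abel
  have hex : ∀ ω n, ω ∈ P n → ∃ m ≤ n, ω ∈ G m := fun ω n hω => by
    classical
    have h : ∃ k, ω ∈ P k := ⟨n, hω⟩
    exact ⟨Nat.find h, Nat.find_min' h hω,
      mem_disjointed_iff.2 ⟨Nat.find_spec h, fun i hi => Nat.find_min h hi⟩⟩
  have hYnorm : ∀ n ω, ‖Y n ω‖ₑ ≤ (P n).indicator (fun ω => ‖X n ω‖ₑ) ω + S ω := by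
    intro n ω
    by_cases hω : ω ∈ P n
    · obtain ⟨m, hmn, hm⟩ := hex ω n hω
      rw [hYm m ω hm, min_eq_right hmn, Set.indicator_of_mem hω]
      exact enorm_sub_le.trans (add_le_add le_rfl (hS m ω hm))
    · have : Y n ω = 0 := Finset.sum_eq_zero fun k hk =>
        Set.indicator_of_notMem (fun hk' => hω (hPmono (Finset.mem_range.1 hk).le hk')) _
      simp [this]
  have hYI : ∀ n, ∫⁻ ω, ‖Y n ω‖ₑ ∂μ ≤ 2 * I := fun n => by
    refine (lintegral_mono (hYnorm n)).trans ?_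
    rw [lintegral_add_right _ hSm, lintegral_indicator (ℱ.le n _ (hP n)), two_mul]
    refine add_le_add ?_ hSI
    exact (setLIntegral_enorm_condExp_le (ℱ.le n) f (hP n)).trans
      (lintegral_mono_set (Set.subset_iUnion P n))
  -- The three copies of `t` bound the R-bound before `τ`, the norm `‖X τ‖`, and the R-bound of `Y`.
  have hsub : {ω | 3 * (t : ℝ≥0∞) < radMax ι X ω} ⊆
      {ω | (t : ℝ≥0∞) ≤ S ω} ∪ {ω | (t : ℝ≥0∞) < radMax ι Y ω} := by
    intro ω hω
    by_contra hcon
    simp only [Set.mem_union, Set.mem_ofPred_eq, not_or, not_le, not_lt] at hcon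
    have ht3 : (t : ℝ≥0∞) ≤ 3 * t := le_mul_of_one_le_left' (by norm_num)
    obtain ⟨n, hn⟩ := lt_radMax_iff_exists_min.1 (ht3.trans_lt hω)
    obtain ⟨m, -, hm⟩ := hex ω n hn
    have hω' : 3 * (t : ℝ≥0∞) < radMax ι X ω := hω
    refine not_lt.2 ?_ hω'
    calc radMax ι X ω = radMax ι (fun j ω => X (min j m) ω + Y j ω) ω :=
          radMax_congr fun j => by rw [hYm m ω hm]; abel
      _ ≤ radMax ι (fun j => X (min j m)) ω + radMax ι Y ω := radMax_add_le _ _ ω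
      _ ≤ t + t + t := by
          refine add_le_add ((radMax_min_le_add hι fun i hi => ?_).trans
            (add_le_add le_rfl ((hS m ω hm).trans hcon.1.le))) hcon.2
          exact not_lt.1 ((mem_disjointed_iff.1 hm).2 i hi)
      _ = 3 * t := by ring
  have ht0 : (t : ℝ≥0∞) ≠ 0 := by exact_mod_cast ht.ne'
  calc μ {ω | 3 * (t : ℝ≥0∞) < radMax ι X ω}
      ≤ μ {ω | (t : ℝ≥0∞) ≤ S ω} + μ {ω | (t : ℝ≥0∞) < radMax ι Y ω} :=
        (measure_mono hsub).trans (measure_union_le _ _)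
    _ ≤ I / t + C / t * (2 * I) := by
        refine add_le_add ?_ (hC Ω m μ ℱ Y hY _ (by finiteness) hYI t ht)
        rw [ENNReal.le_div_iff_mul_le (Or.inl ht0) (Or.inl ENNReal.coe_ne_top), mul_comm]
        exact (mul_meas_ge_le_lintegral hSm t).trans hSI
    _ = _ := by
        push_cast
        simp only [div_eq_mul_inv]
        ring

/-- Under weak RMF, the Rademacher maximal operator is bounded on `L^p` over finite measure
spaces, uniformly in the measure space and in the filtration. -/
theorem HasWeakRMF.exists_lintegral_le (hι : ∀ T : 𝓧, ‖ι T‖ ≤ ‖T‖) (h : HasWeakRMF.{w} ι)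
    {p : ℝ} (hp : 1 < p) :
    ∃ K : ℝ≥0, ∀ (Ω : Type w) (m : MeasurableSpace Ω) (μ : Measure Ω) [IsFiniteMeasure μ]
      (ℱ : Filtration ℕ m) (f : Ω → 𝓧), Integrable f μ →
        ∫⁻ ω, radMax ι (fun n => μ[f | ℱ n]) ω ^ p ∂μ ≤ K * ∫⁻ ω, ‖f ω‖ₑ ^ p ∂μ := by
  obtain ⟨C, hC⟩ := h.exists_meas_le_setLIntegral hι
  obtain ⟨K, hK⟩ := lintegral_rpow_le_of_meas_le.{w} hp C
  exact ⟨K, fun Ω m μ _ ℱ f hf => hK Ω m μ _ _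
    (measurable_radMax hι fun n => stronglyMeasurable_condExp.mono (ℱ.le n))
    hf.aestronglyMeasurable.enorm (hC Ω m μ ℱ f hf)⟩

end Strong

/-! ### Passage to `σ`-finite measures and index set `ℤ`. -/

section SigmaFinite

variable {𝕜 H E 𝓧 : Type*} [RCLike 𝕜] [NormedAddCommGroup H] [NormedSpace 𝕜 H]
  [NormedAddCommGroup E] [NormedSpace 𝕜 E] [NormedAddCommGroup 𝓧] [NormedSpace 𝕜 𝓧]
  [NormedSpace ℝ 𝓧] [CompleteSpace 𝓧] {ι : 𝓧 →ₗ[𝕜] H →L[𝕜] E}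

/-- A `σ`-finite measure on a `σ`-algebra gives a countable measurable partition into sets of finite
measure. -/
theorem exists_partition_lt_top {Ω : Type*} {m m0 : MeasurableSpace Ω} {μ : Measure Ω}
    (hm : m ≤ m0) [SigmaFinite (μ.trim hm)] :
    ∃ D : ℕ → Set Ω, (∀ n, MeasurableSet[m] (D n)) ∧ (∀ n, μ (D n) < ∞) ∧
      Pairwise (Function.onFun Disjoint D) ∧ ⋃ n, D n = Set.univ := by
  refine ⟨disjointed (spanningSets (μ.trim hm)), fun n => MeasurableSet.disjointed
    (fun i => measurableSet_spanningSets (μ.trim hm) i) n, fun n => ?_, disjoint_disjointed _, ?_⟩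
  · refine (measure_mono (disjointed_subset _ n)).trans_lt ?_
    rw [← trim_measurableSet_eq hm (measurableSet_spanningSets (μ.trim hm) n)]
    exact measure_spanningSets_lt_top _ n
  · rw [iUnion_disjointed, iUnion_spanningSets]

/-- On a set of finite measure, a conditional expectation in the sense of `IsCondExp` is given by
the conditional expectation of integrable functions. -/
theorem IsCondExp.ae_restrict_eq {Ω : Type*} {m m0 : MeasurableSpace Ω} {μ : Measure Ω}
    (hm : m ≤ m0) {f g : Ω → 𝓧} (hg : IsCondExp m μ f g) {D : Set Ω} (hD : MeasurableSet[m] D)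
    (hDf : μ D < ∞) (hf : IntegrableOn f D μ) :
    g =ᵐ[μ.restrict D] (μ.restrict D)[f | m] := by
  have : IsFiniteMeasure (μ.restrict D) := ⟨by simpa using hDf⟩
  refine ae_eq_condExp_of_forall_setIntegral_eq hm hf (fun s hs _ => ?_) (fun s hs _ => ?_)
    (hg.aestronglyMeasurable.mono_measure Measure.restrict_le_self)
  · exact (hg.integrableOn D hD hDf).integrableOn
  · rw [Measure.restrict_restrict (hm s hs)]
    exact hg.setIntegral_eq _ (hs.inter hD) ((measure_mono Set.inter_subset_right).trans_lt hDf)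

/-- The bound on finite measure spaces has a uniform constant, so its `p`-th powers add up over a
partition. Indices `≥ -k` are treated first, and `k` tends to infinity by monotone convergence. -/
theorem HasWeakRMF.hasRMF (hι : ∀ T : 𝓧, ‖ι T‖ ≤ ‖T‖) (h : HasWeakRMF.{w} ι)
    {p : ℝ} (hp : 1 < p) : HasRMF.{w} ι p := by
  obtain ⟨K, hK⟩ := h.exists_lintegral_le hι hp
  have hp0 : 0 < p := by linarith
  intro Ω m μ _ ℱ _
  refine ⟨K ^ p⁻¹, fun f hf Y hY => ?_⟩
  have hYm : ∀ j, AEStronglyMeasurable (Y j) μ := fun j =>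
    (hY j).aestronglyMeasurable.mono (ℱ.le j)
  have hshift : ∀ k : ℕ, ∫⁻ ω, radMax ι (fun n : ℕ => Y (n - k)) ω ^ p ∂μ ≤
      K * ∫⁻ ω, ‖f ω‖ₑ ^ p ∂μ := by
    intro k
    -- The pieces lie in `ℱ (-k)`, hence in every later `σ`-algebra, so conditioning commutes with
    -- restriction to a piece.
    obtain ⟨D, hD, hDf, hDd, hDU⟩ := exists_partition_lt_top (μ := μ) (ℱ.le (-k))
    have hD0 : ∀ i, MeasurableSet (D i) := fun i => ℱ.le _ _ (hD i)
    let 𝒢 : Filtration ℕ m :=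
      { seq := fun n => ℱ (n - k)
        mono' := fun a b hab => ℱ.mono (by simpa using hab)
        le' := fun n => ℱ.le _ }
    have hpart : ∀ F : Ω → ℝ≥0∞, ∫⁻ ω, F ω ∂μ = ∑' i, ∫⁻ ω in D i, F ω ∂μ := fun F => by
      rw [← lintegral_iUnion hD0 hDd, hDU, setLIntegral_univ]
    rw [hpart, hpart, ← ENNReal.tsum_mul_left]
    refine ENNReal.tsum_le_tsum fun i => ?_
    have : IsFiniteMeasure (μ.restrict (D i)) := ⟨by simpa using hDf i⟩
    have hfi : IntegrableOn f (D i) μ :=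
      (hf.restrict (D i)).integrable (by simpa using hp.le)
    refine le_of_eq_of_le (lintegral_congr_ae ?_) (hK Ω m (μ.restrict (D i)) 𝒢 f hfi)
    have hae : ∀ n : ℕ, Y (n - k) =ᵐ[μ.restrict (D i)] (μ.restrict (D i))[f | 𝒢 n] := fun n =>
      (hY (n - k)).ae_restrict_eq (ℱ.le _) (ℱ.mono (by simp) _ (hD i)) (hDf i) hfi
    filter_upwards [ae_all_iff.2 hae] with ω hω
    rw [radMax_congr hω]
  have hmono : ∀ ω, Monotone fun k : ℕ => radMax ι (fun n : ℕ => Y (n - k)) ω := by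
    intro ω a b hab
    have := radMax_reindex_le (ι := ι) (fun n : ℕ => Y (n - b)) (fun n : ℕ => n + (b - a)) ω
    refine le_of_eq_of_le (radMax_congr fun n => ?_) this
    congr 1
    push_cast [Nat.cast_sub hab]
    ring
  have hsup : ∀ ω, radMax ι Y ω = ⨆ k : ℕ, radMax ι (fun n : ℕ => Y (n - k)) ω := by
    intro ω
    refine le_antisymm (le_of_forall_lt fun c hc => ?_)
      (iSup_le fun k => radMax_reindex_le Y (fun n : ℕ => (n : ℤ) - k) ω)
    lift c to ℝ≥0 using hc.ne_top
    obtain ⟨N, s, x, hx⟩ := lt_radMax_iff.1 hc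
    set k := ∑ j, (s j).natAbs with hk
    have hs : ∀ j, -(k : ℤ) ≤ s j := fun j => by
      have := Finset.single_le_sum (f := fun j => (s j).natAbs) (by simp) (Finset.mem_univ j)
      rw [← hk] at this
      omega
    refine lt_of_lt_of_le ?_ (le_iSup _ k)
    refine lt_radMax_iff.2 ⟨N, fun j => (s j + k).toNat, x, hx.trans_eq ?_⟩
    congr 1
    funext j
    have : (((s j + k).toNat : ℕ) : ℤ) - k = s j := by have := hs j; omega
    rw [this]
  have hlim : Filter.Tendsto (fun k : ℕ => ∫⁻ ω, radMax ι (fun n : ℕ => Y (n - k)) ω ^ p ∂μ)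
      Filter.atTop (nhds (∫⁻ ω, radMax ι Y ω ^ p ∂μ)) := by
    refine lintegral_tendsto_of_tendsto_of_monotone
      (fun k => (aemeasurable_radMax hι fun n => hYm _).pow_const p)
      (ae_of_all _ fun ω a b hab => ENNReal.rpow_le_rpow (hmono ω hab) hp0.le)
      (ae_of_all _ fun ω => ?_)
    refine (ENNReal.continuous_rpow_const.tendsto _).comp ?_
    rw [hsup]
    exact tendsto_atTop_iSup (hmono ω)
  have hmain := le_of_tendsto' hlim hshift
  rw [eLpNorm_eq_lintegral_rpow_enorm_toReal (by simpa using hp0) ENNReal.ofReal_ne_top,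
    eLpNorm_eq_lintegral_rpow_enorm_toReal (by simpa using hp0) ENNReal.ofReal_ne_top,
    ENNReal.toReal_ofReal hp0.le, one_div, ENNReal.coe_rpow_of_nonneg _ (by positivity),
    ← ENNReal.mul_rpow_of_nonneg _ _ (by positivity)]
  exact ENNReal.rpow_le_rpow hmain (by positivity)

end SigmaFinite

/-! ### Countable disjoint unions of filtered probability spaces. -/

section Sigma

variable {Ω : ℕ → Type w}

theorem measurableSet_sigma_iff {m : ∀ k, MeasurableSpace (Ω k)} {s : Set (Σ k, Ω k)} :
    MeasurableSet s ↔ ∀ k, MeasurableSet (Sigma.mk k ⁻¹' s) :=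
  MeasurableSpace.measurableSet_iInf

theorem measurableEmbedding_sigmaMk (m : ∀ k, MeasurableSpace (Ω k)) (k : ℕ) :
    MeasurableEmbedding (Sigma.mk k : Ω k → Σ k, Ω k) where
  injective := sigma_mk_injective
  measurable := fun _ hs => measurableSet_sigma_iff.1 hs k
  measurableSet_image' := by
    intro s hs
    refine measurableSet_sigma_iff.2 fun i => ?_
    rcases eq_or_ne i k with rfl | hik
    · rwa [Set.preimage_image_eq _ sigma_mk_injective]
    · rw [show Sigma.mk i ⁻¹' (Sigma.mk k '' s) = ∅ from Set.eq_empty_of_forall_notMem ?_]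
      · exact MeasurableSet.empty
      · rintro x ⟨y, -, hy⟩
        exact hik (congrArg Sigma.fst hy).symm

theorem measurableSet_range_sigmaMk (m : ∀ k, MeasurableSpace (Ω k)) (k : ℕ) :
    MeasurableSet (Set.range (Sigma.mk k : Ω k → Σ k, Ω k)) :=
  (measurableEmbedding_sigmaMk m k).measurableSet_range

theorem stronglyMeasurable_extend_sigmaMk {F : Type*} [TopologicalSpace F] [Zero F]
    (m : ∀ k, MeasurableSpace (Ω k)) {k : ℕ} {f : Ω k → F} (hf : StronglyMeasurable f) :
    StronglyMeasurable (Function.extend (Sigma.mk k) f (0 : (Σ k, Ω k) → F)) :=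
  (measurableEmbedding_sigmaMk m k).stronglyMeasurable_extend hf stronglyMeasurable_zero

/-- The filtration on a disjoint union given by filtrations on the pieces. -/
def sigmaFiltration {J : Type*} [Preorder J] {m : ∀ k, MeasurableSpace (Ω k)}
    (ℱ : ∀ k, Filtration J (m k)) :
    Filtration J (Sigma.instMeasurableSpace : MeasurableSpace (Σ k, Ω k)) where
  seq j := @Sigma.instMeasurableSpace _ _ fun k => ℱ k j
  mono' _ _ hij _ hs := (measurableSet_sigma_iff (m := fun k => ℱ k _)).2 fun k =>
    (ℱ k).mono hij _ ((measurableSet_sigma_iff (m := fun k => ℱ k _)).1 hs k)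
  le' j _ hs := measurableSet_sigma_iff.2 fun k =>
    (ℱ k).le j _ ((measurableSet_sigma_iff (m := fun k => ℱ k _)).1 hs k)

variable {m : ∀ k, MeasurableSpace (Ω k)} (ℙ : ∀ k, Measure (Ω k))

/-- The disjoint union of measures. -/
noncomputable def sigmaMeasure : Measure (Σ k, Ω k) :=
  Measure.sum fun k => (ℙ k).map (Sigma.mk k)

theorem sigmaMeasure_restrict_range (k : ℕ) :
    (sigmaMeasure ℙ).restrict (Set.range (Sigma.mk k)) = (ℙ k).map (Sigma.mk k) := by
  ext s hs
  have hr := (measurableEmbedding_sigmaMk m k).measurableSet_range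
  rw [Measure.restrict_apply hs, sigmaMeasure, Measure.sum_apply _ (hs.inter hr), tsum_eq_single k]
  · rw [Measure.map_apply (measurableEmbedding_sigmaMk m k).measurable (hs.inter hr),
      Measure.map_apply (measurableEmbedding_sigmaMk m k).measurable hs]
    congr 1
    ext x
    simp
  · intro i hi
    rw [Measure.map_apply (measurableEmbedding_sigmaMk m i).measurable (hs.inter hr)]
    convert measure_empty (μ := ℙ i)
    refine Set.eq_empty_of_forall_notMem ?_
    rintro x ⟨-, y, hy⟩
    exact hi (congrArg Sigma.fst hy).symm

theorem eLpNorm_sigmaMeasure {F : Type*} [TopologicalSpace F] [ESeminormedAddMonoid F] (k : ℕ)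
    {g : (Σ k, Ω k) → F} (hg : ∀ ω, ω ∉ Set.range (Sigma.mk k) → g ω = 0) (p : ℝ≥0∞) :
    eLpNorm g p (sigmaMeasure ℙ) = eLpNorm (fun ω => g ⟨k, ω⟩) p (ℙ k) := by
  have hind : g = (Set.range (Sigma.mk k)).indicator g := by
    funext ω
    by_cases h : ω ∈ Set.range (Sigma.mk k)
    · rw [Set.indicator_of_mem h]
    · rw [Set.indicator_of_notMem h, hg ω h]
  conv_lhs => rw [hind]
  rw [eLpNorm_indicator_eq_eLpNorm_restrict (measurableEmbedding_sigmaMk m k).measurableSet_range,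
    sigmaMeasure_restrict_range, (measurableEmbedding_sigmaMk m k).eLpNorm_map_measure]
  rfl

theorem setIntegral_sigmaMeasure {F : Type*} [NormedAddCommGroup F] [NormedSpace ℝ F] (k : ℕ)
    {g : (Σ k, Ω k) → F} (hg : ∀ ω, ω ∉ Set.range (Sigma.mk k) → g ω = 0) {A : Set (Σ k, Ω k)}
    (hA : MeasurableSet A) :
    ∫ ω in A, g ω ∂(sigmaMeasure ℙ) = ∫ ω in Sigma.mk k ⁻¹' A, g ⟨k, ω⟩ ∂(ℙ k) := by
  have hemb := measurableEmbedding_sigmaMk m k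
  rw [← hemb.setIntegral_map, ← sigmaMeasure_restrict_range, Measure.restrict_restrict hA,
    ← setIntegral_indicator hemb.measurableSet_range]
  congr 1
  funext ω
  by_cases h : ω ∈ Set.range (Sigma.mk k)
  · rw [Set.indicator_of_mem h]
  · rw [Set.indicator_of_notMem h, hg ω h]

/-- Each piece is measurable for every member of the filtration and has mass one, and there are
countably many pieces. -/
theorem sigmaFinite_sigmaMeasure_trim [∀ k, IsProbabilityMeasure (ℙ k)]
    {J : Type*} [Preorder J] (ℱ : ∀ k, Filtration J (m k)) (j : J) :
    SigmaFinite ((sigmaMeasure ℙ).trim ((sigmaFiltration ℱ).le j)) := by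
  have hr : ∀ k, MeasurableSet[sigmaFiltration ℱ j] (Set.range (Sigma.mk k : Ω k → Σ k, Ω k)) :=
    fun k => measurableSet_range_sigmaMk (fun k => ℱ k j) k
  refine Measure.sigmaFinite_of_countable
    (S := Set.range fun k => Set.range (Sigma.mk k : Ω k → Σ k, Ω k)) (Set.countable_range _) ?_ ?_
  · rintro _ ⟨k, rfl⟩
    rw [trim_measurableSet_eq _ (hr k), ← Measure.restrict_apply_univ,
      sigmaMeasure_restrict_range]
    have := Measure.isProbabilityMeasure_map (μ := ℙ k)
      (measurableEmbedding_sigmaMk m k).measurable.aemeasurable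
    exact measure_lt_top _ _
  · refine Set.eq_univ_of_forall fun ω => ?_
    exact ⟨_, ⟨ω.1, rfl⟩, ω.2, rfl⟩

end Sigma

/-! ### Uniformity of the `RMF_p` constant. -/

section Uniform

variable {𝕜 H E 𝓧 : Type*} [RCLike 𝕜] [NormedAddCommGroup H] [NormedSpace 𝕜 H]
  [NormedAddCommGroup E] [NormedSpace 𝕜 E] [NormedAddCommGroup 𝓧] [NormedSpace 𝕜 𝓧]
  [NormedSpace ℝ 𝓧] [CompleteSpace 𝓧] {ι : 𝓧 →ₗ[𝕜] H →L[𝕜] E}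

/-- The constant in `RMF_p` may be chosen uniformly: otherwise the disjoint union of filtered
probability spaces with large constants would have no finite constant. -/
theorem HasRMF.exists_uniform {p : ℝ} (h : HasRMF.{w} ι p) :
    ∃ C : ℝ≥0, ∀ (Ω : Type w) (m : MeasurableSpace Ω) (ℙ : Measure Ω) [IsProbabilityMeasure ℙ]
      (ℱ : Filtration ℕ m) (X : ℕ → Ω → 𝓧), Martingale X ℱ ℙ → ∀ n : ℕ,
      MemLp (X n) (ENNReal.ofReal p) ℙ →
      eLpNorm (radMax ι fun j => X (min j n)) (ENNReal.ofReal p) ℙ ≤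
        C * eLpNorm (X n) (ENNReal.ofReal p) ℙ := by
  by_contra hcon
  push Not at hcon
  -- The `k`-th space violates the inequality with constant `k`. A single constant `C` for the union
  -- is contradicted by any piece with `k ≥ C`.
  choose Ω m ℙ hℙ ℱ X hX n hM hlt using fun k : ℕ => hcon k
  let 𝒢 : ∀ k, Filtration ℤ (m k) := fun k =>
    { seq := fun j => ℱ k j.toNat
      mono' := fun a b hab => (ℱ k).mono (Int.toNat_le_toNat hab)
      le' := fun j => (ℱ k).le _ }
  have hσ : SigmaFiniteFiltration (sigmaMeasure ℙ) (sigmaFiltration 𝒢) :=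
    ⟨sigmaFinite_sigmaMeasure_trim ℙ 𝒢⟩
  have hσ' : SigmaFinite (sigmaMeasure ℙ) := SigmaFinite.of_trim
    ((sigmaFiltration 𝒢).le 0)
  obtain ⟨C, hC⟩ := h (Σ k, Ω k) _ (sigmaMeasure ℙ) (sigmaFiltration 𝒢)
  obtain ⟨k, hk⟩ := exists_nat_ge C
  let e : (Ω k → 𝓧) → (Σ k, Ω k) → 𝓧 := fun f => Function.extend (Sigma.mk k) f (0 : (Σ k, Ω k) → 𝓧)
  have he : ∀ (f : Ω k → 𝓧) ω, e f ⟨k, ω⟩ = f ω := fun f ω => sigma_mk_injective.extend_apply f 0 ω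
  have he0 : ∀ (f : Ω k → 𝓧) ω, ω ∉ Set.range (Sigma.mk k) → e f ω = 0 := fun f ω hω =>
    Function.extend_apply' f (0 : (Σ k, Ω k) → 𝓧) ω hω
  have hemem : ∀ (f : Ω k → 𝓧) (q : ℝ≥0∞), StronglyMeasurable f → MemLp f q (ℙ k) →
      MemLp (e f) q (sigmaMeasure ℙ) := fun f q hfm hf => by
    refine ⟨(stronglyMeasurable_extend_sigmaMk m hfm).aestronglyMeasurable, ?_⟩
    rw [eLpNorm_sigmaMeasure ℙ k (he0 f)]
    simpa only [he] using hf.2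
  have hXm : ∀ i, StronglyMeasurable (X k i) := fun i => ((hX k).1 i).mono ((ℱ k).le i)
  -- The conditional expectations of `X k (n k)`, extended by zero to the other pieces. Negative
  -- indices repeat time `0`, as in `𝒢`.
  let Y : ℤ → (Σ k, Ω k) → 𝓧 := fun j => e (X k (min j.toNat (n k)))
  have hY : ∀ j, IsCondExp (sigmaFiltration 𝒢 j) (sigmaMeasure ℙ) (e (X k (n k))) (Y j) := by
    intro j
    refine ⟨?_, fun A hA _ => ?_, fun A hA _ => ?_⟩
    · exact (stronglyMeasurable_extend_sigmaMk (fun k => 𝒢 k j)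
        (((hX k).1 _).mono ((ℱ k).mono (min_le_left _ _)))).aestronglyMeasurable
    · exact (memLp_one_iff_integrable.1 (hemem _ 1 (hXm _)
        (memLp_one_iff_integrable.2 ((hX k).integrable _)))).integrableOn
    · have hA' : MeasurableSet[ℱ k j.toNat] (Sigma.mk k ⁻¹' A) :=
        (measurableSet_sigma_iff (m := fun k => 𝒢 k j)).1 hA k
      have hA0 := (sigmaFiltration 𝒢).le j A hA
      rw [setIntegral_sigmaMeasure ℙ k (he0 _) hA0, setIntegral_sigmaMeasure ℙ k (he0 _) hA0]
      simp only [he]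
      rcases le_total j.toNat (n k) with hj | hj
      · rw [min_eq_left hj, (hX k).setIntegral_eq hj hA']
      · rw [min_eq_right hj]
  have hbound := hC (e (X k (n k))) (hemem _ _ (hXm _) (hM k)) Y hY
  rw [eLpNorm_sigmaMeasure ℙ k (he0 _), eLpNorm_sigmaMeasure ℙ k (g := radMax ι Y)
    fun ω hω => radMax_eq_zero fun j => he0 _ _ hω] at hbound
  simp only [he] at hbound
  refine absurd (hlt k) (not_lt.2 (le_trans ?_ (hbound.trans (mul_le_mul_left ?_ _))))
  · refine eLpNorm_mono_enorm fun ω => ?_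
    have := radMax_reindex_le (ι := ι) (fun j : ℤ => X k (min j.toNat (n k))) (Nat.cast : ℕ → ℤ) ω
    simp only [Int.toNat_natCast] at this
    exact this.trans_eq (radMax_congr fun j => (he _ _).symm)
  · exact_mod_cast hk

end Uniform

/-! ### Predictable stopping and the Gundy decomposition. -/

section Gundy

variable {Ω F : Type*} [NormedAddCommGroup F]

/-- A martingale `M` run only while a decreasing predictable sequence of events `Q` lasts. -/
noncomputable def predictableStop (M : ℕ → Ω → F) (Q : ℕ → Set Ω) (n : ℕ) (ω : Ω) : F :=
  M 0 ω + ∑ k ∈ Finset.range n, (Q (k + 1)).indicator (M (k + 1) - M k) ω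

theorem predictableStop_of_mem {M : ℕ → Ω → F} {Q : ℕ → Set Ω} (hQ : Antitone Q) {n : ℕ} {ω : Ω}
    (hω : ω ∈ Q n) : predictableStop M Q n ω = M n ω := by
  have : ∀ k ∈ Finset.range n, (Q (k + 1)).indicator (M (k + 1) - M k) ω =
      M (k + 1) ω - M k ω := fun k hk => by
    rw [Set.indicator_of_mem (hQ (Finset.mem_range.1 hk) hω), Pi.sub_apply]
  rw [predictableStop, Finset.sum_congr rfl this, Finset.sum_range_sub (fun k => M k ω)]
  abel

theorem predictableStop_succ_of_notMem {M : ℕ → Ω → F} {Q : ℕ → Set Ω} {n : ℕ} {ω : Ω}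
    (hω : ω ∉ Q (n + 1)) : predictableStop M Q (n + 1) ω = predictableStop M Q n ω := by
  rw [predictableStop, Finset.sum_range_succ, Set.indicator_of_notMem hω, add_zero,
    predictableStop]

variable [NormedSpace ℝ F] [CompleteSpace F]
  {m : MeasurableSpace Ω} {ℙ : Measure Ω} [IsFiniteMeasure ℙ] {ℱ : Filtration ℕ m}

theorem martingale_predictableStop {M : ℕ → Ω → F} (hM : Martingale M ℱ ℙ) {Q : ℕ → Set Ω}
    (hQ : ∀ n, MeasurableSet[ℱ n] (Q (n + 1))) : Martingale (predictableStop M Q) ℱ ℙ :=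
  (martingale_const_fun ℱ ℙ (hM.1 0) (hM.integrable 0)).add
    (martingale_sum_indicator hM hQ)

/-- On `Q (n + 1)` the stopped process still equals `M`; off it the process is frozen. Cancelling
the finite integral over `Q (n + 1)` in the induction hypothesis leaves a bound on the complement,
which lies in `ℱ n`, and there the `L^1` norm of `M` increases with time. -/
theorem lintegral_enorm_predictableStop_le {M : ℕ → Ω → F} (hM : Martingale M ℱ ℙ)
    {Q : ℕ → Set Ω} (hQ : ∀ n, MeasurableSet[ℱ n] (Q (n + 1))) (hQa : Antitone Q) (n : ℕ) :
    ∫⁻ ω, ‖predictableStop M Q n ω‖ₑ ∂ℙ ≤ ∫⁻ ω, ‖M n ω‖ₑ ∂ℙ := by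
  induction n with
  | zero => simp [predictableStop]
  | succ n ih =>
    have hQm : MeasurableSet (Q (n + 1)) := ℱ.le n _ (hQ n)
    have h1 : ∫⁻ ω in Q (n + 1), ‖predictableStop M Q (n + 1) ω‖ₑ ∂ℙ =
        ∫⁻ ω in Q (n + 1), ‖M (n + 1) ω‖ₑ ∂ℙ :=
      setLIntegral_congr_fun hQm fun ω hω => by simp only [predictableStop_of_mem hQa hω]
    have h2 : ∫⁻ ω in (Q (n + 1))ᶜ, ‖predictableStop M Q (n + 1) ω‖ₑ ∂ℙ =
        ∫⁻ ω in (Q (n + 1))ᶜ, ‖predictableStop M Q n ω‖ₑ ∂ℙ :=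
      setLIntegral_congr_fun hQm.compl fun ω hω => by
        simp only [predictableStop_succ_of_notMem hω]
    have h3 : ∫⁻ ω in Q (n + 1), ‖predictableStop M Q n ω‖ₑ ∂ℙ =
        ∫⁻ ω in Q (n + 1), ‖M n ω‖ₑ ∂ℙ :=
      setLIntegral_congr_fun hQm fun ω hω => by
        simp only [predictableStop_of_mem hQa (hQa n.le_succ hω)]
    rw [← lintegral_add_compl (μ := ℙ) (fun ω => ‖predictableStop M Q n ω‖ₑ) hQm, h3,
      ← lintegral_add_compl (μ := ℙ) (fun ω => ‖M n ω‖ₑ) hQm,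
      ENNReal.add_le_add_iff_left
        (ne_top_of_le_ne_top (hM.integrable n).2.ne (setLIntegral_le_lintegral _ _))] at ih
    rw [← lintegral_add_compl (μ := ℙ) (fun ω => ‖predictableStop M Q (n + 1) ω‖ₑ) hQm, h1, h2,
      ← lintegral_add_compl (μ := ℙ) (fun ω => ‖M (n + 1) ω‖ₑ) hQm]
    exact add_le_add le_rfl
      (ih.trans (setLIntegral_enorm_martingale_le hM n.le_succ (hQ n).compl))

/-- The terms of an `L^1`-bounded martingale at a stopping time, in `L^1`. -/
theorem tsum_setLIntegral_martingale_le {X : ℕ → Ω → F} (hX : Martingale X ℱ ℙ) {A : ℝ≥0∞}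
    (hA : ∀ n, ∫⁻ ω, ‖X n ω‖ₑ ∂ℙ ≤ A) {G : ℕ → Set Ω} (hG : ∀ k, MeasurableSet[ℱ k] (G k))
    (hd : Pairwise (Function.onFun Disjoint G)) :
    ∑' k, ∫⁻ ω in G k, ‖X k ω‖ₑ ∂ℙ ≤ A := by
  refine ENNReal.tsum_le_of_sum_range_le fun n => ?_
  calc ∑ k ∈ Finset.range n, ∫⁻ ω in G k, ‖X k ω‖ₑ ∂ℙ
      ≤ ∑ k ∈ Finset.range n, ∫⁻ ω in G k, ‖X n ω‖ₑ ∂ℙ :=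
        Finset.sum_le_sum fun k hk =>
          setLIntegral_enorm_martingale_le hX (Finset.mem_range.1 hk).le (hG k)
    _ ≤ ∑' k, ∫⁻ ω in G k, ‖X n ω‖ₑ ∂ℙ := ENNReal.sum_le_tsum _
    _ = ∫⁻ ω in ⋃ k, G k, ‖X n ω‖ₑ ∂ℙ := (lintegral_iUnion (fun k => ℱ.le k _ (hG k)) hd _).symm
    _ ≤ A := (setLIntegral_le_lintegral _ _).trans (hA n)

/-- A decomposition of Gundy type: an `L^1`-bounded martingale agrees, outside the set where it
exceeds `r` and the set where the variation of a predictable process `∑ v` exceeds `r`, with the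
difference of a martingale bounded by `2 r` and this predictable process. -/
theorem exists_gundy {X : ℕ → Ω → F} (hX : Martingale X ℱ ℙ) {A : ℝ≥0∞}
    (hA : ∀ n, ∫⁻ ω, ‖X n ω‖ₑ ∂ℙ ≤ A) (r : ℝ≥0) :
    ∃ (D v : ℕ → Ω → F) (T : Set Ω), Martingale D ℱ ℙ ∧ (∀ n ω, ‖D n ω‖ₑ ≤ 2 * r) ∧
      (∀ n, ∫⁻ ω, ‖D n ω‖ₑ ∂ℙ ≤ 2 * A) ∧ (∀ k, StronglyMeasurable (v k)) ∧
      ∑' k, ∫⁻ ω, ‖v k ω‖ₑ ∂ℙ ≤ A ∧ r * ℙ T ≤ A ∧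
      ∀ ω ∉ T, ∑' k, ‖v k ω‖ₑ ≤ r → ∀ n, X n ω = D n ω + ∑ k ∈ Finset.range n, -v k ω := by
  set P : ℕ → Set Ω := fun n => {ω | (r : ℝ≥0∞) < ‖X n ω‖ₑ} with hPdef
  have hP : ∀ n, MeasurableSet[ℱ n] (P n) := fun n => by
    have : Measurable[ℱ n] fun ω => ‖X n ω‖ₑ := (hX.1 n).enorm
    exact this measurableSet_Ioi
  set G := disjointed P with hGdef
  have hG : ∀ n, MeasurableSet[ℱ n] (G n) := measurableSet_disjointed_filtration hP
  have hG0 : ∀ n, MeasurableSet (G n) := fun n => ℱ.le n _ (hG n)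
  have hGd : Pairwise (Function.onFun Disjoint G) := disjoint_disjointed P
  have hXG := tsum_setLIntegral_martingale_le hX hA hG hGd
  set N : ℕ → Set Ω := fun n => ⋂ i ≤ n, (P i)ᶜ with hNdef
  have hN : ∀ n, MeasurableSet[ℱ n] (N n) := fun n =>
    MeasurableSet.iInter fun i => MeasurableSet.iInter fun hi => (ℱ.mono hi _ (hP i)).compl
  have hN0 : ∀ n, MeasurableSet (N n) := fun n => ℱ.le n _ (hN n)
  have hNmem : ∀ n ω, ω ∈ N n ↔ ∀ i ≤ n, ω ∉ P i := fun n ω => by simp [hNdef]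
  set Z : ℕ → Ω → F := fun n => (N n).indicator (X n) with hZdef
  have hZm : ∀ n, StronglyMeasurable[ℱ n] (Z n) := fun n => (hX.1 n).indicator (hN n)
  have hZi : ∀ n, Integrable (Z n) ℙ := fun n => (hX.integrable n).indicator (hN0 n)
  set g : ℕ → Ω → F := fun n => (G n).indicator (X n) with hgdef
  have hgi : ∀ n, Integrable (g n) ℙ := fun n => (hX.integrable n).indicator (hG0 n)
  -- `Z` is `X` killed at its first passage above `r`, and `g` is the value at that passage. Since
  -- `Z (n + 1) + g (n + 1)` is `X (n + 1)` on `N n` and zero elsewhere, its conditional expectation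
  -- given `ℱ n` is `Z n`. So `v` compensates `Z` to the martingale `M`.
  set v : ℕ → Ω → F := fun k => ℙ[g (k + 1) | ℱ k] with hvdef
  have hvm : ∀ k, StronglyMeasurable[ℱ k] (v k) := fun k => stronglyMeasurable_condExp
  have hvi : ∀ k, Integrable (v k) ℙ := fun k => integrable_condExp
  have hvA : ∑' k, ∫⁻ ω, ‖v k ω‖ₑ ∂ℙ ≤ A := by
    calc ∑' k, ∫⁻ ω, ‖v k ω‖ₑ ∂ℙ ≤ ∑' k, ∫⁻ ω in G (k + 1), ‖X (k + 1) ω‖ₑ ∂ℙ := by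
          refine ENNReal.tsum_le_tsum fun k => ?_
          have := setLIntegral_enorm_condExp_le (μ := ℙ) (ℱ.le k) (g (k + 1)) MeasurableSet.univ
          simp only [setLIntegral_univ, hgdef, enorm_indicator_eq_indicator_enorm] at this
          rwa [lintegral_indicator (hG0 _)] at this
      _ ≤ ∑' k, ∫⁻ ω in G k, ‖X k ω‖ₑ ∂ℙ :=
          ENNReal.tsum_comp_le_tsum_of_injective (add_left_injective 1) _
      _ ≤ A := hXG
  have hZg : ∀ n ω, Z (n + 1) ω + g (n + 1) ω = (N n).indicator (X (n + 1)) ω := by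
    intro n ω
    by_cases hω : ω ∈ N n
    · rw [Set.indicator_of_mem hω]
      rw [hNmem] at hω
      by_cases h1 : ω ∈ P (n + 1)
      · have h2 : ω ∉ N (n + 1) := fun h => (hNmem _ _).1 h _ le_rfl h1
        have h3 : ω ∈ G (n + 1) :=
          mem_disjointed_iff.2 ⟨h1, fun i hi => hω i (Nat.lt_succ_iff.1 hi)⟩
        simp [hZdef, hgdef, h2, h3]
      · have h2 : ω ∈ N (n + 1) := (hNmem _ _).2 fun i hi => by
          rcases Nat.le_succ_iff.1 hi with h | rfl
          exacts [hω i h, h1]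
        have h3 : ω ∉ G (n + 1) := fun h => h1 (mem_disjointed_iff.1 h).1
        simp [hZdef, hgdef, h2, h3]
    · have h2 : ω ∉ N (n + 1) := fun h =>
        hω ((hNmem _ _).2 fun i hi => (hNmem _ _).1 h i (hi.trans n.le_succ))
      have h3 : ω ∉ G (n + 1) := fun h =>
        hω ((hNmem _ _).2 fun i hi => (mem_disjointed_iff.1 h).2 i (Nat.lt_succ_iff.2 hi))
      simp [hZdef, hgdef, h2, h3, hω]
  set M : ℕ → Ω → F := fun n ω => Z n ω + ∑ k ∈ Finset.range n, v k ω with hMdef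
  have hsum_i : ∀ n, Integrable (fun ω => ∑ k ∈ Finset.range n, v k ω) ℙ := fun n =>
    integrable_finsetSum _ fun k _ => hvi k
  have hM : Martingale M ℱ ℙ := by
    refine martingale_of_setIntegral_eq_succ (fun n => ?_) (fun n => (hZi n).add (hsum_i n))
      fun n s hs => ?_
    · exact (hZm n).add (Finset.stronglyMeasurable_fun_sum _ fun k hk =>
        (hvm k).mono (ℱ.mono (Finset.mem_range.1 hk).le))
    · simp only [hMdef, Finset.sum_range_succ]
      rw [integral_add (hZi n).integrableOn (hsum_i n).integrableOn,
        integral_add (g := fun ω => ∑ k ∈ Finset.range n, v k ω + v n ω)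
          (hZi (n + 1)).integrableOn ((hsum_i n).add (hvi n)).integrableOn,
        integral_add (hsum_i n).integrableOn (hvi n).integrableOn,
        setIntegral_condExp (ℱ.le n) (hgi (n + 1)) hs]
      have h1 : ∫ ω in s, Z (n + 1) ω ∂ℙ + ∫ ω in s, g (n + 1) ω ∂ℙ = ∫ ω in s, Z n ω ∂ℙ := by
        rw [← integral_add (hZi (n + 1)).integrableOn (hgi (n + 1)).integrableOn]
        simp_rw [hZg]
        rw [setIntegral_indicator (hN0 n), setIntegral_indicator (hN0 n)]
        exact (hX.setIntegral_eq n.le_succ (hs.inter (hN n))).symm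
      rw [← h1]
      abel
  have hMA : ∀ n, ∫⁻ ω, ‖M n ω‖ₑ ∂ℙ ≤ 2 * A := by
    intro n
    calc ∫⁻ ω, ‖M n ω‖ₑ ∂ℙ ≤ ∫⁻ ω, (‖X n ω‖ₑ + ∑ k ∈ Finset.range n, ‖v k ω‖ₑ) ∂ℙ := by
          refine lintegral_mono fun ω => (enorm_add_le _ _).trans (add_le_add ?_ (enorm_sum_le _ _))
          simp only [hZdef, enorm_indicator_eq_indicator_enorm]
          exact Set.indicator_le_self _ _ _
      _ = ∫⁻ ω, ‖X n ω‖ₑ ∂ℙ + ∑ k ∈ Finset.range n, ∫⁻ ω, ‖v k ω‖ₑ ∂ℙ := by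
          rw [lintegral_add_left ((hX.1 n).mono (ℱ.le n)).enorm,
            lintegral_finsetSum _ fun k _ => ((hvm k).mono (ℱ.le k)).enorm]
      _ ≤ 2 * A := by
          rw [two_mul]
          exact add_le_add (hA n) ((ENNReal.sum_le_tsum _).trans hvA)
  -- `Q (n + 1)` involves only `v 0, …, v n` and so lies in `ℱ n`. Hence `M` can be stopped before
  -- its compensator exceeds `r`, which keeps it bounded by `2 * r`.
  set Q : ℕ → Set Ω := fun n => {ω | ∑ k ∈ Finset.range n, ‖v k ω‖ₑ ≤ r} with hQdef
  have hQa : Antitone Q := fun a b hab ω hω =>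
    
    le_trans (Finset.sum_le_sum_of_subset (f := fun k => ‖v k ω‖ₑ) (Finset.range_mono hab)) hω
  have hQ : ∀ n, MeasurableSet[ℱ n] (Q (n + 1)) := fun n => by
    have : Measurable[ℱ n] fun ω => ∑ k ∈ Finset.range (n + 1), ‖v k ω‖ₑ :=
      Finset.measurable_fun_sum _ fun k hk =>
        ((hvm k).mono (ℱ.mono (Nat.lt_succ_iff.1 (Finset.mem_range.1 hk)))).enorm
    exact this measurableSet_Iic
  have hZr : ∀ n ω, ‖Z n ω‖ₑ ≤ r := fun n ω => by
    by_cases h : ω ∈ N n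
    · simp only [hZdef, Set.indicator_of_mem h]
      exact not_lt.1 ((hNmem _ _).1 h n le_rfl)
    · simp [hZdef, h]
  have hMr : ∀ n, ∀ ω ∈ Q n, ‖M n ω‖ₑ ≤ 2 * r := fun n ω hω => by
    rw [two_mul]
    exact (enorm_add_le _ _).trans (add_le_add (hZr n ω) ((enorm_sum_le _ _).trans hω))
  refine ⟨predictableStop M Q, v, ⋃ n, P n, martingale_predictableStop hM hQ, fun n ω => ?_,
    fun n => (lintegral_enorm_predictableStop_le hM hQ hQa n).trans (hMA n),
    fun k => (hvm k).mono (ℱ.le k), hvA, ?_, fun ω hω hv n => ?_⟩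
  · induction n with
    | zero =>
      rw [predictableStop_of_mem hQa (by simp [hQdef])]
      exact hMr 0 ω (by simp [hQdef])
    | succ n ih =>
      by_cases h : ω ∈ Q (n + 1)
      · rw [predictableStop_of_mem hQa h]
        exact hMr _ _ h
      · rwa [predictableStop_succ_of_notMem h]
  · rw [← iUnion_disjointed, measure_iUnion hGd hG0, ← ENNReal.tsum_mul_left]
    refine (ENNReal.tsum_le_tsum fun k => ?_).trans hXG
    rw [← setLIntegral_const]
    exact setLIntegral_mono' (hG0 k) fun ω hω => (mem_disjointed_iff.1 hω).1.le
  · have hωQ : ω ∈ Q n := (ENNReal.sum_le_tsum _).trans hv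
    have hωN : ω ∈ N n := (hNmem _ _).2 fun i _ hi => hω (Set.mem_iUnion.2 ⟨i, hi⟩)
    rw [predictableStop_of_mem hQa hωQ, Finset.sum_neg_distrib]
    simp [hMdef, hZdef, hωN]

end Gundy

/-! ### `RMF_p` implies weak RMF. -/

section Weak

variable {𝕜 H E 𝓧 : Type*} [RCLike 𝕜] [NormedAddCommGroup H] [NormedSpace 𝕜 H]
  [NormedAddCommGroup E] [NormedSpace 𝕜 E] [NormedAddCommGroup 𝓧] [NormedSpace 𝕜 𝓧]
  [NormedSpace ℝ 𝓧] [CompleteSpace 𝓧] {ι : 𝓧 →ₗ[𝕜] H →L[𝕜] E}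

/-- The weak type inequality for bounded martingales follows from `RMF_p` by Chebyshev's
inequality. -/
theorem HasRMF.exists_meas_le_of_bounded (hι : ∀ T : 𝓧, ‖ι T‖ ≤ ‖T‖) {p : ℝ} (hp : 1 < p)
    (h : HasRMF.{w} ι p) :
    ∃ K : ℝ≥0, ∀ (Ω : Type w) (m : MeasurableSpace Ω) (ℙ : Measure Ω) [IsProbabilityMeasure ℙ]
      (ℱ : Filtration ℕ m) (D : ℕ → Ω → 𝓧), Martingale D ℱ ℙ → ∀ (A : ℝ≥0∞) (r : ℝ≥0), 0 < r →
      (∀ n ω, ‖D n ω‖ₑ ≤ 2 * r) → (∀ n, ∫⁻ ω, ‖D n ω‖ₑ ∂ℙ ≤ A) →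
      ℙ {ω | (r : ℝ≥0∞) < radMax ι D ω} ≤ K / r * A := by
  obtain ⟨C, hC⟩ := h.exists_uniform
  have hp0 : 0 < p := by linarith
  -- Chebyshev gives `r ^ (-p) * C ^ p * ‖D n‖_p ^ p`, and the bound `2 * r` gives `‖D n‖_p ^ p ≤ (2
  -- * r) ^ (p - 1) * A`. The powers of `r` combine to `1 / r`.
  refine ⟨C ^ p * 2 ^ (p - 1), fun Ω m ℙ _ ℱ D hD A r hr hDr hDA => ?_⟩
  have hr0 : (r : ℝ≥0∞) ≠ 0 := by exact_mod_cast hr.ne'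
  set S : ℕ → Set Ω := fun n => {ω | (r : ℝ≥0∞) < radMax ι (fun j => D (min j n)) ω} with hSdef
  have hSU : {ω | (r : ℝ≥0∞) < radMax ι D ω} = ⋃ n, S n := by
    ext ω
    rw [Set.mem_iUnion]
    exact lt_radMax_iff_exists_min
  have hS : Monotone S := fun a b hab ω hω => lt_of_lt_of_le hω (radMax_min_mono D ω hab)
  rw [hSU, hS.measure_iUnion]
  refine iSup_le fun n => ?_
  have hDm : ∀ i, StronglyMeasurable (D i) := fun i => (hD.1 i).mono (ℱ.le i)
  have hLp : MemLp (D n) (ENNReal.ofReal p) ℙ := by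
    refine MemLp.of_bound (hDm n).aestronglyMeasurable (2 * r) (ae_of_all _ fun ω => ?_)
    have := ENNReal.toReal_mono (by finiteness) (hDr n ω)
    simpa using this
  set R := radMax ι fun j => D (min j n) with hRdef
  have hRm : Measurable R := measurable_radMax hι fun j => hDm _
  have hmain : ∫⁻ ω, R ω ^ p ∂ℙ ≤ C ^ p * ∫⁻ ω, ‖D n ω‖ₑ ^ p ∂ℙ := by
    have := hC Ω m ℙ ℱ D hD n hLp
    rw [eLpNorm_eq_lintegral_rpow_enorm_toReal (by simpa using hp0) ENNReal.ofReal_ne_top,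
      eLpNorm_eq_lintegral_rpow_enorm_toReal (by simpa using hp0) ENNReal.ofReal_ne_top,
      ENNReal.toReal_ofReal hp0.le] at this
    have := ENNReal.rpow_le_rpow this hp0.le
    rw [ENNReal.mul_rpow_of_nonneg _ _ hp0.le, ← ENNReal.rpow_mul, ← ENNReal.rpow_mul,
      one_div_mul_cancel hp0.ne', ENNReal.rpow_one, ENNReal.rpow_one] at this
    exact this
  have hDp : ∫⁻ ω, ‖D n ω‖ₑ ^ p ∂ℙ ≤ (2 * r) ^ (p - 1) * A := by
    calc ∫⁻ ω, ‖D n ω‖ₑ ^ p ∂ℙ ≤ ∫⁻ ω, (2 * r) ^ (p - 1) * ‖D n ω‖ₑ ∂ℙ := by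
          refine lintegral_mono fun ω => ?_
          rw [← ennreal_mul_rpow_sub_one hp, mul_comm]
          gcongr
          exact hDr n ω
      _ ≤ (2 * r) ^ (p - 1) * A := by
          rw [lintegral_const_mul' _ _ (by finiteness)]
          gcongr
          exact hDA n
  have hcheb : (r : ℝ≥0∞) ^ p * ℙ (S n) ≤ ∫⁻ ω, R ω ^ p ∂ℙ := by
    refine le_trans ?_ (mul_meas_ge_le_lintegral (hRm.pow_const p) ((r : ℝ≥0∞) ^ p))
    refine mul_le_mul_right (measure_mono fun ω hω => ?_) _
    exact ENNReal.rpow_le_rpow (le_of_lt hω) hp0.le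
  have hrp : (r : ℝ≥0∞) ^ p ≠ 0 := by simpa [hp0] using hr.ne'
  have hrpt : (r : ℝ≥0∞) ^ p ≠ ∞ := by finiteness
  have hrr : (r : ℝ≥0∞) ^ (p - 1) = r ^ p * (r : ℝ≥0∞)⁻¹ := by
    rw [ENNReal.rpow_sub _ _ hr0 ENNReal.coe_ne_top, ENNReal.rpow_one, div_eq_mul_inv]
  rw [← ENNReal.mul_le_mul_iff_right hrp hrpt]
  refine (hcheb.trans (hmain.trans (mul_le_mul_right hDp _))).trans_eq ?_
  rw [ENNReal.mul_rpow_of_nonneg _ _ (by linarith), hrr]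
  push_cast [ENNReal.coe_rpow_of_nonneg _ hp0.le, ENNReal.coe_rpow_of_nonneg _ (sub_pos.2 hp).le]
  rw [div_eq_mul_inv]
  ring

/-- The Gundy decomposition at height `r = t / 2` leaves `r` for the bounded martingale and `r` for
the variation of the predictable part. -/
theorem HasRMF.hasWeakRMF (hι : ∀ T : 𝓧, ‖ι T‖ ≤ ‖T‖) {p : ℝ} (hp : 1 < p)
    (h : HasRMF.{w} ι p) : HasWeakRMF.{w} ι := by
  obtain ⟨K, hK⟩ := h.exists_meas_le_of_bounded hι hp
  -- The two exceptional sets cost `A / r` each and the bounded martingale `K / r * (2 * A)`; the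
  -- outer `2` is from `1 / r = 2 / t`.
  refine ⟨2 * (2 + 2 * K), fun Ω m ℙ _ ℱ X hX hA t ht => ?_⟩
  set A := ⨆ j, eLpNorm (X j) 1 ℙ with hAdef
  have hXA : ∀ n, ∫⁻ ω, ‖X n ω‖ₑ ∂ℙ ≤ A := fun n => by
    rw [← eLpNorm_one_eq_lintegral_enorm]
    exact le_iSup (fun j => eLpNorm (X j) 1 ℙ) n
  set r : ℝ≥0 := t / 2 with hrdef
  have hr : 0 < r := by positivity
  have hr0 : (r : ℝ≥0∞) ≠ 0 := by exact_mod_cast hr.ne'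
  have htr : (t : ℝ≥0∞) = r + r := by rw [hrdef, ← ENNReal.coe_add, add_halves]
  obtain ⟨D, v, T, hD, hDr, hDA, hvm, hvA, hT, hXD⟩ := exists_gundy hX hXA r
  have hsub : {ω | (t : ℝ≥0∞) < radMax ι X ω} ⊆
      T ∪ {ω | (r : ℝ≥0∞) ≤ ∑' k, ‖v k ω‖ₑ} ∪ {ω | (r : ℝ≥0∞) < radMax ι D ω} := by
    intro ω hω
    by_contra hcon
    simp only [Set.mem_union, Set.mem_ofPred_eq, not_or, not_le, not_lt] at hcon
    obtain ⟨⟨hωT, hv⟩, hωD⟩ := hcon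
    have hω' : (t : ℝ≥0∞) < radMax ι X ω := hω
    refine not_lt.2 ?_ hω'
    calc radMax ι X ω = radMax ι (fun n ω => D n ω + ∑ k ∈ Finset.range n, -v k ω) ω :=
          radMax_congr fun n => hXD ω hωT hv.le n
      _ ≤ radMax ι D ω + radMax ι (fun n ω => ∑ k ∈ Finset.range n, -v k ω) ω :=
          radMax_add_le _ _ ω
      _ ≤ r + r := by
          refine add_le_add hωD ((radMax_sum_range_le hι (fun k ω => -v k ω) ω).trans ?_)
          simpa using hv.le
      _ = t := htr.symm
  have hle : ∀ x : ℝ≥0∞, r * x ≤ A → x ≤ A / r := fun x hx => by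
    rwa [ENNReal.le_div_iff_mul_le (Or.inl hr0) (Or.inl ENNReal.coe_ne_top), mul_comm]
  have hv : ℙ {ω | (r : ℝ≥0∞) ≤ ∑' k, ‖v k ω‖ₑ} ≤ A / r := by
    refine hle _ ((mul_meas_ge_le_lintegral (Measurable.tsum fun k => (hvm k).enorm) _).trans ?_)
    rwa [lintegral_tsum fun k => (hvm k).enorm.aemeasurable]
  calc ℙ {ω | (t : ℝ≥0∞) < radMax ι X ω}
      ≤ ℙ T + ℙ {ω | (r : ℝ≥0∞) ≤ ∑' k, ‖v k ω‖ₑ} + ℙ {ω | (r : ℝ≥0∞) < radMax ι D ω} :=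
        (measure_mono hsub).trans ((measure_union_le _ _).trans
          (add_le_add (measure_union_le _ _) le_rfl))
    _ ≤ A / r + A / r + K / r * (2 * A) :=
        add_le_add (add_le_add (hle _ hT) hv) (hK Ω m ℙ ℱ D hD _ r hr hDr hDA)
    _ = _ := by
        have h2 : (r : ℝ≥0∞)⁻¹ = 2 * (t : ℝ≥0∞)⁻¹ := by
          rw [← ENNReal.coe_inv hr.ne', ← ENNReal.coe_inv ht.ne', hrdef, inv_div, div_eq_mul_inv]
          push_cast
          rfl
        push_cast
        simp only [div_eq_mul_inv, h2]
        ring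

end Weak

end RademacherMaximal

theorem mainTheorem1 {𝕜 H E 𝓧 : Type*} [RCLike 𝕜]
    [NormedAddCommGroup H] [NormedSpace 𝕜 H] [CompleteSpace H]
    [NormedAddCommGroup E] [NormedSpace 𝕜 E] [CompleteSpace E]
    [NormedAddCommGroup 𝓧] [NormedSpace 𝕜 𝓧] [NormedSpace ℝ 𝓧] [IsScalarTower ℝ 𝕜 𝓧]
    [CompleteSpace 𝓧]
    (ι : 𝓧 →ₗ[𝕜] H →L[𝕜] E) (hι_inj : Function.Injective ι) (hι_norm : ∀ T : 𝓧, ‖ι T‖ ≤ ‖T‖) :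
    List.TFAE [
      ∀ p : ℝ, 1 < p → RademacherMaximal.HasRMF.{w} ι p,
      ∃ p : ℝ, 1 < p ∧ RademacherMaximal.HasRMF.{w} ι p,
      RademacherMaximal.HasWeakRMF.{w} ι] := by
  tfae_have 1 → 2 := fun h => ⟨2, by norm_num, h 2 (by norm_num)⟩
  tfae_have 2 → 3 := fun ⟨_, hp, h⟩ => h.hasWeakRMF hι_norm hp
  tfae_have 3 → 1 := fun h _ hp => h.hasRMF hι_norm hp
  tfae_finish
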